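/- Let $q_0,q_1,q_2$ be the vertices of an equilateral triangle in $\mathbb R^2$ (indices mod 3), $F_i(x)=\tfrac12(x-q_i)+q_i$, and let $SG$ be the Sierpinski gasket, the nonempty compact set with $SG=\bigcup_{i}F_i(SG)$. For a word $w=(w_1,\dots,w_m)$ put $F_w=F_{w_1}\circ\cdots\circ F_{w_m}$; the sets $F_w(SG)$ are the cells of level $m$. Let $\mu$ be the natural probability measure on $SG$, of mass $3^{-m}$ on each cell of level $m$, and let $\langle\cdot,\cdot\rangle$ and $\|\cdot\|$ be the inner product and norm of the real space $L^2(SG,\mu)$. Let $V_0=\{q_0,q_1,q_2\}$, $V_{m+1}=\bigcup_iF_iV_m$, and write $x\sim_m y$ if $x\ne y$ in $V_m$ lie in a common cell of level $m$. For continuous $u,f$ on $SG$, $\Delta u=f$ means that $\tfrac32 5^m\sum_{y\sim_m x}(u(y)-u(x))\to f(x)$ as $m\to\infty$, uniformly over $x\in V_m\setminus V_0$. Let $\mathcal H^j$ be the set of $u$ with $\Delta^{j+1}u=0$ (polynomials of degree at most $j$; $\mathcal H^0$ consists of the harmonic functions). Let $$\partial_nu(q_i)=\lim_{m\to\infty}(5/3)^m\bigl(2u(q_i)-u(F_i^mq_{i+1})-u(F_i^mq_{i-1})\bigr),\qquad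 \partial_Tu(q_i)=\lim_{m\to\infty}5^m\bigl(u(F_i^mq_{i+1})-u(F_i^mq_{i-1})\bigr).$$ For $n\in\{0,1,2\}$, $i\in\{1,2,3\}$ and $j\ge0$ the monomial $P^{(n)}_{ji}$ is the function in $\mathcal H^j$ with $\Delta^mP^{(n)}_{ji}(q_n)=\delta_{mj}\delta_{i1}$, $\partial_n\Delta^mP^{(n)}_{ji}(q_n)=\delta_{mj}\delta_{i2}$ and $\partial_T\Delta^mP^{(n)}_{ji}(q_n)=\delta_{mj}\delta_{i3}$ for $0\le m\le j$. Let $G(x,y)=\lim_{M\to\infty}\sum_{m=0}^M\sum_{z,z'\in V_{m+1}\setminus V_m}g(z,z')\psi^{(m+1)}_z(x)\psi^{(m+1)}_{z'}(y)$ be the Green function. Here, for $z,z'\in V_{m+1}\setminus V_m$, $g(z,z)=\tfrac9{50}(\tfrac35)^m$, $g(z,z')=\tfrac3{50}(\tfrac35)^m$ if $z\ne z'$ lie in a common cell of level $m+1$, and $g(z,z')=0$ otherwise; $\psi^{(m+1)}_z$ is the function that is harmonic on every cell of level $m+1$ (that is, $\psi_z^{(m+1)}\circ F_w$ is harmonic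 for each word $w$ of length $m+1$), equals $\delta_{zx}$ at each $x\in V_{m+1}$, and vanishes outside the cells of level $m+1$ containing $z$. **Theorem.** Fix $n\in\{0,1,2\}$ and $i\in\{2,3\}$, write $P_k=P^{(n)}_{ki}$, and let $p_k=P_k-\sum_{l<k}\|p_l\|^{-2}\langle P_k,p_l\rangle p_l$ ($k\ge 0$) be the orthogonal polynomials obtained from $(P_k)_{k\ge0}$ by the Gram–Schmidt process; put $p_{-1}=0$, so that $p_0=P_0$. Then the limit defining $G$ exists at all $x,y\in SG$, $\|p_k\|>0$ for all $k\ge0$, and with $d_k=\|p_k\|^{-1}$, $f_0=0$ and $$f_{k+1}(x)=-\int_{SG}G(x,y)\,p_k(y)\,d\mu(y)\qquad(k\ge0)$$ the integrals converge, $f_{k+1}\in\mathcal H^{k+1}$, and for every $k\ge0$ $$p_{k+1}=f_{k+1}-b_kp_k-c_kp_{k-1}\quad\text{on } SG,$$ where $b_k=d_k^2\langle f_{k+1},p_k\rangle$ for $k\ge 0$ and $c_k=\dfrac{d_{k-1}^2}{d_k^2}=\dfrac{\|p_k\|^2}{\|p_{k-1}\|^2}$ for $k\ge1$ (the value of $c_0$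 plays no role, since $p_{-1}=0$). Consequently, for every $k\ge0$, $d_k^{-2}=\|p_k\|^2=d_0^{-2}\,c_1c_2\cdots c_k$. -/

import Mathlib

open MeasureTheory Filter Topology

namespace SGasket

/-- The Euclidean plane. -/
abbrev Plane : Type := EuclideanSpace ℝ (Fin 2)

/-- `q 0, q 1, q 2` are the vertices of a (nondegenerate) equilateral triangle. -/
def IsEquilateral (q : Fin 3 → Plane) : Prop :=
  ∃ s : ℝ, 0 < s ∧ ∀ i j : Fin 3, i ≠ j → dist (q i) (q j) = s

/-- The contraction `F_i x = (x - q_i) / 2 + q_i` of the plane. -/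
noncomputable def contraction (q : Fin 3 → Plane) (i : Fin 3) (x : Plane) : Plane :=
  (1 / 2 : ℝ) • (x - q i) + q i

/-- The point with address `ω`, i.e. the limit of `F_{ω 0} ∘ ⋯ ∘ F_{ω m}` (at any point of the
plane) as `m → ∞`. -/
noncomputable def address (q : Fin 3 → Plane) (ω : ℕ → Fin 3) : Plane :=
  ∑' k : ℕ, ((1 / 2 : ℝ) ^ (k + 1)) • q (ω k)

/-- The Sierpinski gasket: the set of all points with an address. That this is the attractor of the
iterated function system `F_0, F_1, F_2` is proved in `isCompact_gasket`, `gasket_nonempty` and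
`gasket_eq_iUnion`. -/
def gasket (q : Fin 3 → Plane) : Set Plane := Set.range (address q)

theorem summable_address_bound (q : Fin 3 → Plane) :
    Summable (fun k : ℕ => (1 / 2 : ℝ) ^ (k + 1) * ∑ i, ‖q i‖) := by
  have h : Summable (fun k : ℕ => (1 / 2 : ℝ) ^ k) :=
    summable_geometric_of_lt_one (by norm_num) (by norm_num)
  exact ((summable_nat_add_iff 1).2 h).mul_right _

theorem norm_address_le (q : Fin 3 → Plane) (k : ℕ) (ω : ℕ → Fin 3) :
    ‖((1 / 2 : ℝ) ^ (k + 1)) • q (ω k)‖ ≤ (1 / 2 : ℝ) ^ (k + 1) * ∑ i, ‖q i‖ := by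
  rw [norm_smul, Real.norm_of_nonneg (by positivity)]
  gcongr
  exact Finset.single_le_sum (f := fun i => ‖q i‖) (fun i _ => norm_nonneg _) (Finset.mem_univ _)

theorem summable_address (q : Fin 3 → Plane) (ω : ℕ → Fin 3) :
    Summable (fun k : ℕ => ((1 / 2 : ℝ) ^ (k + 1)) • q (ω k)) :=
  Summable.of_norm_bounded (summable_address_bound q) (fun k => norm_address_le q k ω)

theorem continuous_address (q : Fin 3 → Plane) : Continuous (address q) := by
  refine continuous_tsum (fun k => ?_) (summable_address_bound q) (fun k ω => norm_address_le q k ω)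
  have h : Continuous (fun ω : ℕ → Fin 3 => q (ω k)) :=
    (continuous_of_discreteTopology (f := q)).comp (continuous_apply (A := fun _ : ℕ => Fin 3) k)
  exact h.const_smul ((1 / 2 : ℝ) ^ (k + 1))

theorem contraction_address (q : Fin 3 → Plane) (ω : ℕ → Fin 3) :
    contraction q (ω 0) (address q (fun k => ω (k + 1))) = address q ω := by
  unfold contraction address
  rw [(summable_address q ω).tsum_eq_zero_add]
  have h : ∑' k : ℕ, ((1 / 2 : ℝ) ^ (k + 1 + 1)) • q (ω (k + 1)) =
      (1 / 2 : ℝ) • ∑' k : ℕ, ((1 / 2 : ℝ) ^ (k + 1)) • q (ω (k + 1)) := by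
    rw [← (summable_address q (fun k => ω (k + 1))).tsum_const_smul]
    refine tsum_congr (fun k => ?_)
    rw [smul_smul, pow_succ' _ (k + 1)]
  rw [h]
  module

theorem contraction_mem (q : Fin 3 → Plane) (i : Fin 3) {x : Plane} (hx : x ∈ gasket q) :
    contraction q i x ∈ gasket q := by
  obtain ⟨ω, rfl⟩ := hx
  exact ⟨fun k => Nat.casesOn k i ω, (contraction_address q (fun k => Nat.casesOn k i ω)).symm⟩

theorem isCompact_gasket (q : Fin 3 → Plane) : IsCompact (gasket q) :=
  isCompact_range (continuous_address q)

theorem gasket_nonempty (q : Fin 3 → Plane) : (gasket q).Nonempty :=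
  Set.range_nonempty _

theorem gasket_eq_iUnion (q : Fin 3 → Plane) :
    gasket q = ⋃ i : Fin 3, contraction q i '' gasket q := by
  apply Set.Subset.antisymm
  · rintro _ ⟨ω, rfl⟩
    exact Set.mem_iUnion.2 ⟨ω 0, _, ⟨_, rfl⟩, contraction_address q ω⟩
  · refine Set.iUnion_subset (fun i => ?_)
    rintro _ ⟨x, hx, rfl⟩
    exact contraction_mem q i hx

theorem vertex_mem (q : Fin 3 → Plane) (i : Fin 3) : q i ∈ gasket q := by
  refine ⟨fun _ => i, ?_⟩
  have h : HasSum (fun k : ℕ => (1 / 2 : ℝ) ^ (k + 1)) 1 := by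
    simpa [pow_succ, div_eq_mul_inv, mul_comm] using hasSum_geometric_two' (1 : ℝ)
  have h2 := (h.smul_const (q i)).tsum_eq
  simpa [address] using h2

/-- The boundary point `q_i` as a point of the gasket. -/
def corner (q : Fin 3 → Plane) (i : Fin 3) : gasket q := ⟨q i, vertex_mem q i⟩

/-- `F_i` as a self-map of the gasket. -/
noncomputable def mapF (q : Fin 3 → Plane) (i : Fin 3) (x : gasket q) : gasket q :=
  ⟨contraction q i x, contraction_mem q i x.2⟩

/-- `F_w = F_{w_1} ∘ ⋯ ∘ F_{w_m}` for a word `w`. -/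
noncomputable def mapW (q : Fin 3 → Plane) : List (Fin 3) → gasket q → gasket q
  | [] => id
  | i :: w => mapF q i ∘ mapW q w

/-- The cell `F_w(SG)`, of level `w.length`. -/
def cell (q : Fin 3 → Plane) (w : List (Fin 3)) : Set (gasket q) := Set.range (mapW q w)

/-- Two points lie in a common cell of level `m`. -/
def SameCell (q : Fin 3 → Plane) (m : ℕ) (x y : gasket q) : Prop :=
  ∃ w : List (Fin 3), w.length = m ∧ x ∈ cell q w ∧ y ∈ cell q w

open scoped Classical in
/-- The vertex sets: `V_0 = {q_0, q_1, q_2}` and `V_{m+1} = ⋃ i, F_i V_m`. -/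
noncomputable def vertices (q : Fin 3 → Plane) : ℕ → Finset (gasket q)
  | 0 => Finset.univ.image (corner q)
  | m + 1 => Finset.univ.biUnion (fun i : Fin 3 => (vertices q m).image (mapF q i))

open scoped Classical in
/-- The neighbours of `x` in the graph `Γ_m`: the vertices `y ≠ x` in `V_m` that lie in a common
cell of level `m` with `x`. -/
noncomputable def neighbors (q : Fin 3 → Plane) (m : ℕ) (x : gasket q) : Finset (gasket q) :=
  (vertices q m).filter (fun y => y ≠ x ∧ SameCell q m x y)

/-- The graph Laplacian `Δ_m u(x) = ∑_{y ~_m x} (u(y) - u(x))`. -/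
noncomputable def graphLaplacian (q : Fin 3 → Plane) (m : ℕ) (u : gasket q → ℝ) (x : gasket q) : ℝ :=
  ∑ y ∈ neighbors q m x, (u y - u x)

/-- `u` is in the domain of the Laplacian and `Δ u = f`: both functions are continuous on `SG`, and
`(3/2) 5^m Δ_m u` converges to `f` as `m → ∞`, uniformly on `V_* \ V_0` (at level `m` the
expression makes sense at the points of `V_m \ V_0`). -/
def HasLaplacian (q : Fin 3 → Plane) (u f : gasket q → ℝ) : Prop :=
  Continuous u ∧ Continuous f ∧
    ∀ ε : ℝ, 0 < ε → ∃ N : ℕ, ∀ m : ℕ, N ≤ m → ∀ x ∈ vertices q m, x ∉ vertices q 0 →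
      |3 / 2 * 5 ^ m * graphLaplacian q m u x - f x| < ε

/-- `Δ^m u = f`. -/
def HasLaplacianIter (q : Fin 3 → Plane) : ℕ → (gasket q → ℝ) → (gasket q → ℝ) → Prop
  | 0, u, f => u = f
  | m + 1, u, f => ∃ v, HasLaplacian q u v ∧ HasLaplacianIter q m v f

/-- `u` belongs to `ℋ^j`, the polynomials of degree at most `j`: `Δ^{j+1} u = 0`. -/
def IsPolynomial (q : Fin 3 → Plane) (j : ℕ) (u : gasket q → ℝ) : Prop :=
  HasLaplacianIter q (j + 1) u 0

/-- The normal derivative `∂_n u(q_i)` exists and equals `a`; indices are taken modulo 3. -/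
def HasNormalDeriv (q : Fin 3 → Plane) (u : gasket q → ℝ) (i : Fin 3) (a : ℝ) : Prop :=
  Tendsto (fun m : ℕ => (5 / 3 : ℝ) ^ m *
    (2 * u (corner q i) - u ((mapF q i)^[m] (corner q (i + 1)))
      - u ((mapF q i)^[m] (corner q (i - 1))))) atTop (𝓝 a)

/-- The tangential derivative `∂_T u(q_i)` exists and equals `a`; indices are taken modulo 3. -/
def HasTangentialDeriv (q : Fin 3 → Plane) (u : gasket q → ℝ) (i : Fin 3) (a : ℝ) : Prop :=
  Tendsto (fun m : ℕ => (5 : ℝ) ^ m *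
    (u ((mapF q i)^[m] (corner q (i + 1))) - u ((mapF q i)^[m] (corner q (i - 1)))))
    atTop (𝓝 a)

/-- `P` is the monomial `P_{ji}^{(n)}`, where `i` is 1, 2 or 3: it belongs to `ℋ^j`, and for
`0 ≤ m ≤ j` its `m`-th Laplacian has at `q_n` the value `δ_{mj} δ_{i1}`, the normal derivative
`δ_{mj} δ_{i2}` and the tangential derivative `δ_{mj} δ_{i3}`. -/
def IsMonomial (q : Fin 3 → Plane) (n : Fin 3) (j i : ℕ) (P : gasket q → ℝ) : Prop :=
  IsPolynomial q j P ∧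
    ∀ m : ℕ, m ≤ j → ∃ v : gasket q → ℝ, HasLaplacianIter q m P v ∧
      v (corner q n) = (if m = j ∧ i = 1 then 1 else 0) ∧
      HasNormalDeriv q v n (if m = j ∧ i = 2 then 1 else 0) ∧
      HasTangentialDeriv q v n (if m = j ∧ i = 3 then 1 else 0)

/-- The fair Bernoulli measure on addresses. -/
noncomputable def fairMeasure : Measure (ℕ → Fin 3) :=
  Measure.infinitePi (fun _ : ℕ => (PMF.uniformOfFintype (Fin 3)).toMeasure)

/-- The natural self-similar probability measure on `SG`, of mass `3^{-m}` on each cell of level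
`m`: the image of the fair Bernoulli measure under the address map. -/
noncomputable def mu (q : Fin 3 → Plane) : Measure (gasket q) :=
  fairMeasure.map (fun ω => (⟨address q ω, ω, rfl⟩ : gasket q))

/-- The inner product of `L²(SG, μ)`. -/
noncomputable def ip (q : Fin 3 → Plane) (u v : gasket q → ℝ) : ℝ := ∫ x, u x * v x ∂(mu q)

/-- The norm of `L²(SG, μ)`. -/
noncomputable def normL2 (q : Fin 3 → Plane) (u : gasket q → ℝ) : ℝ :=
  Real.sqrt (∫ x, u x ^ 2 ∂(mu q))

/-- `ψ` is the piecewise harmonic spline `ψ_z^{(m)}`: harmonic on every cell of level `m`, with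
`ψ(x) = δ_{zx}` at the vertices `x ∈ V_m`, and vanishing outside the cells of level `m` that
contain `z`. -/
def IsSpline (q : Fin 3 → Plane) (m : ℕ) (z : gasket q) (ψ : gasket q → ℝ) : Prop :=
  (∀ w : List (Fin 3), w.length = m → HasLaplacian q (ψ ∘ mapW q w) 0) ∧
    ψ z = 1 ∧ (∀ x ∈ vertices q m, x ≠ z → ψ x = 0) ∧
    ∀ x, ¬ SameCell q m z x → ψ x = 0

open scoped Classical in
/-- The spline `ψ_z^{(m)}` (for `z ∈ V_m` there is exactly one). -/
noncomputable def spline (q : Fin 3 → Plane) (m : ℕ) (z : gasket q) : gasket q → ℝ :=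
  if h : ∃ ψ, IsSpline q m z ψ then h.choose else 0

open scoped Classical in
/-- The coefficients `g(z, z')`, for `z, z' ∈ V_{m+1} \ V_m`. -/
noncomputable def greenCoeff (q : Fin 3 → Plane) (m : ℕ) (z z' : gasket q) : ℝ :=
  if z = z' then 9 / 50 * (3 / 5) ^ m
  else if SameCell q (m + 1) z z' then 3 / 50 * (3 / 5) ^ m
  else 0

open scoped Classical in
/-- The partial sums `G_M(x, y)` of the Green function. -/
noncomputable def greenPartial (q : Fin 3 → Plane) (M : ℕ) (x y : gasket q) : ℝ :=
  ∑ m ∈ Finset.range (M + 1),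
    ∑ z ∈ vertices q (m + 1) \ vertices q m, ∑ z' ∈ vertices q (m + 1) \ vertices q m,
      greenCoeff q m z z' * spline q (m + 1) z x * spline q (m + 1) z' y

/-- The Green function `G(x, y) = lim_{M → ∞} G_M(x, y)`. -/
noncomputable def green (q : Fin 3 → Plane) (x y : gasket q) : ℝ :=
  limUnder atTop (fun M : ℕ => greenPartial q M x y)

/-- The Gram–Schmidt process without normalization:
`p_j = P_j - ∑_{l < j} ‖p_l‖^{-2} ⟨P_j, p_l⟩ p_l`. -/
noncomputable def orthoPoly (q : Fin 3 → Plane) (P : ℕ → gasket q → ℝ) (j : ℕ) : gasket q → ℝ :=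
  P j - ∑ l : Fin j, ((normL2 q (orthoPoly q P l))⁻¹ ^ 2 * ip q (P j) (orthoPoly q P l)) •
    orthoPoly q P l
termination_by j
decreasing_by exact l.2

/-- The sequence `f_0 = 0`, `f_{k+1}(x) = -∫ G(x, y) p_k(y) dμ(y)`. -/
noncomputable def auxPoly (q : Fin 3 → Plane) (p : ℕ → gasket q → ℝ) : ℕ → gasket q → ℝ
  | 0 => 0
  | k + 1 => fun x => -∫ y, green q x y * p k y ∂(mu q)

/-- `k ↦ p_{k-1}`, with `p_{-1} = 0`. -/
def precede {X : Type*} (p : ℕ → X → ℝ) : ℕ → X → ℝ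
  | 0 => 0
  | k + 1 => p k

end SGasket

/-!
The argument rests on three facts about the operator `T p = -∫ G(·, y) p(y) dμ(y)`.

* `T` inverts the Laplacian: `T p` is the only solution of `Δ u = p` that vanishes on `V_0`
  (`hasLaplacian_potential`, `dirichlet_unique`).
* `T` is symmetric in `L²`, because `G` is (`ip_potential_comm`).
* `T P_l - P_{l+1}` is a multiple of `P_0` (`potential_sub_monomial`). Indeed `Δ P_{l+1} = P_l`, so
  the difference is harmonic; it vanishes at `q_n`, and like the monomials it is symmetric (`i = 2`)
  or antisymmetric (`i = 3`) under the reflection that fixes `q_n`. The harmonic functions of this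
  kind form a line, spanned by `P_0`.

Hence `T p_k` equals `P_{k+1}` up to a combination of `P_0, …, P_k`, and it is orthogonal to `p_l`
for `l < k - 1` since `⟨T p_k, p_l⟩ = ⟨p_k, T p_l⟩` and `T p_l` has degree `l + 1`. This gives the
three-term recursion, with `⟨T p_k, p_{k-1}⟩ = ⟨p_k, T p_{k-1}⟩ = ‖p_k‖²`
(`IsGramSchmidt.three_term_succ`).

The analysis uses self-similarity instead of summation by parts. Harmonic functions are built from
the extension rule `1/5`-`2/5`. The Green function satisfies
`G(F_i x, F_j y) = G_0(F_i x, F_j y) + (3/5) δ_ij G(x, y)`, where `G_0` is the first term of its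
series, so that `(T p) ∘ F_i` is a harmonic function plus `(1/5) T(p ∘ F_i)`
(`potential_comp_mapF`). Since the graph Laplacian at `F_i x` only sees the cell `i` unless `F_i x`
is one of the three points where cells of level one meet, the formula for `Δ_m (T p)` follows by
induction on `m` from an exact computation at these points
(`graphLaplacian_potential_junction`). Uniqueness follows from the maximum principle, with `T 1` as
a barrier. It identifies the splines, which are first constructed explicitly (`hat`), and with them
the function `G` that is defined through them.
-/

namespace SGasket

section Geometry

variable {q : Fin 3 → Plane}

/-! ### The contractions and the words -/

theorem exists_mapF_eq (x : gasket q) : ∃ i y, mapF q i y = x := by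
  obtain ⟨i, y, hy, hxy⟩ := Set.mem_iUnion.1 ((gasket_eq_iUnion q).subset x.2)
  exact ⟨i, ⟨y, hy⟩, Subtype.ext hxy⟩

instance : CompactSpace (gasket q) := isCompact_iff_compactSpace.1 (isCompact_gasket q)

instance : Nonempty (gasket q) := (gasket_nonempty q).to_subtype

theorem continuous_contraction (i : Fin 3) : Continuous (contraction q i) := by
  unfold contraction; fun_prop

theorem continuous_mapF (i : Fin 3) : Continuous (mapF q i) :=
  ((continuous_contraction i).comp continuous_subtype_val).subtype_mk _

/-- A continuous function that at least halves on the cells of level one is nonpositive, as one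
sees at its maximum. -/
theorem nonpos_of_comp_mapF_le {e : gasket q → ℝ} (he : Continuous e)
    (h : ∀ i x, e (mapF q i x) ≤ 1 / 2 * e x) (x : gasket q) : e x ≤ 0 := by
  obtain ⟨z, -, hz⟩ := isCompact_univ.exists_isMaxOn Set.univ_nonempty he.continuousOn
  obtain ⟨i, y, hy⟩ := exists_mapF_eq z
  have h1 : e y ≤ e z := hz (Set.mem_univ y)
  have h2 : e x ≤ e z := hz (Set.mem_univ x)
  have h3 := h i y
  rw [hy] at h3
  linarith

theorem mapF_corner_self (i : Fin 3) : mapF q i (corner q i) = corner q i :=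
  Subtype.ext (by simp [mapF, corner, contraction])

theorem mapF_corner_comm (i j : Fin 3) : mapF q i (corner q j) = mapF q j (corner q i) :=
  Subtype.ext (by simp only [mapF, corner, contraction]; module)

theorem mapF_injective (i : Fin 3) : Function.Injective (mapF q i) := by
  intro x y h
  have h1 : contraction q i x = contraction q i y := congrArg Subtype.val h
  simp only [contraction, add_left_inj] at h1
  have h2 := smul_right_injective Plane (by norm_num : (1 / 2 : ℝ) ≠ 0) h1
  exact Subtype.ext (sub_left_injective h2)

@[simp] theorem mapF_inj {i : Fin 3} {x y : gasket q} : mapF q i x = mapF q i y ↔ x = y :=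
  (mapF_injective i).eq_iff

theorem dist_mapW (w : List (Fin 3)) (x y : gasket q) :
    dist (mapW q w x) (mapW q w y) = (1 / 2) ^ w.length * dist x y := by
  induction w with
  | nil => simp [mapW]
  | cons i w ih =>
    have : ∀ a b : gasket q, dist (mapF q i a) (mapF q i b) = 1 / 2 * dist a b := by
      intro a b
      rw [Subtype.dist_eq, Subtype.dist_eq]
      simp only [mapF, contraction, dist_add_right]
      rw [dist_smul₀, dist_sub_right]
      norm_num
    simp only [mapW, Function.comp, this, ih, List.length_cons, pow_succ]
    ring

theorem exists_mapW_eq (m : ℕ) (x : gasket q) :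
    ∃ w y, w.length = m ∧ mapW q w y = x := by
  induction m generalizing x with
  | zero => exact ⟨[], x, rfl, rfl⟩
  | succ m ih =>
    obtain ⟨i, y, rfl⟩ := exists_mapF_eq x
    obtain ⟨w, z, hw, rfl⟩ := ih y
    exact ⟨i :: w, z, by simp [hw], rfl⟩

/-- A continuous function on the gasket oscillates arbitrarily little on the cells of a high
level. -/
theorem exists_oscillation_lt {u : gasket q → ℝ} (hu : Continuous u) {ε : ℝ} (hε : 0 < ε) :
    ∃ N : ℕ, ∀ w : List (Fin 3), N ≤ w.length → ∀ x y, |u (mapW q w x) - u (mapW q w y)| < ε := by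
  obtain ⟨δ, hδ, h⟩ := Metric.uniformContinuous_iff.1
    (CompactSpace.uniformContinuous_of_continuous hu) ε hε
  obtain ⟨C, hC⟩ := Metric.isBounded_iff.1 (isCompact_univ (X := gasket q)).isBounded
  obtain ⟨N, hN⟩ := exists_pow_lt_of_lt_one (show 0 < δ / (|C| + 1) by positivity)
    (by norm_num : (1 / 2 : ℝ) < 1)
  refine ⟨N, fun w hw x y => ?_⟩
  have h1 : dist x y < |C| + 1 :=
    ((hC (Set.mem_univ x) (Set.mem_univ y)).trans (le_abs_self C)).trans_lt (by linarith)
  have h2 : (1 / 2 : ℝ) ^ w.length ≤ (1 / 2) ^ N :=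
    pow_le_pow_of_le_one (by norm_num) (by norm_num) hw
  rw [lt_div_iff₀ (by positivity)] at hN
  have h3 : dist (mapW q w x) (mapW q w y) < δ := by
    rw [dist_mapW]
    calc (1 / 2 : ℝ) ^ w.length * dist x y ≤ (1 / 2) ^ N * (|C| + 1) := by
          gcongr
      _ < δ := hN
  simpa [Real.dist_eq] using h h3

/-! ### Barycentric coordinates and the intersection pattern of the cells -/

/-- The planar cross product. -/
def cross (u v : Plane) : ℝ := u 0 * v 1 - u 1 * v 0

/-- The barycentric coordinate of a point of the plane belonging to the vertex `q i`, as a quotient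
of signed areas. -/
noncomputable def bary (q : Fin 3 → Plane) (i : Fin 3) (x : Plane) : ℝ :=
  cross (q (i + 1) - x) (q (i + 2) - x) / cross (q 1 - q 0) (q 2 - q 0)

theorem IsEquilateral.cross_ne_zero (hq : IsEquilateral q) :
    cross (q 1 - q 0) (q 2 - q 0) ≠ 0 := by
  obtain ⟨s, hs, h⟩ := hq
  have h1 := h 1 0 (by decide)
  have h2 := h 2 0 (by decide)
  have h3 := h 1 2 (by decide)
  rw [EuclideanSpace.dist_eq, Real.sqrt_eq_iff_mul_self_eq_of_pos hs] at h1 h2 h3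
  simp only [Fin.sum_univ_two, Real.dist_eq, sq_abs] at h1 h2 h3
  intro h0
  simp only [cross, PiLp.sub_apply] at h0
  -- Lagrange's identity: the squares of the cross and of the inner product sum to `s ^ 4`.
  have hin : (q 1 0 - q 0 0) * (q 2 0 - q 0 0) + (q 1 1 - q 0 1) * (q 2 1 - q 0 1)
      = s * s / 2 := by linarith
  have hl : (s * s / 2) ^ 2 + 0 ^ 2 = (s * s) * (s * s) := by
    rw [← hin, ← h0]
    calc _ = ((q 1 0 - q 0 0) ^ 2 + (q 1 1 - q 0 1) ^ 2) *
          ((q 2 0 - q 0 0) ^ 2 + (q 2 1 - q 0 1) ^ 2) := by ring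
      _ = _ := by rw [← h1, ← h2]
  have : 0 < s * s * (s * s) := by positivity
  nlinarith

theorem continuous_bary (i : Fin 3) : Continuous (bary q i) := by
  unfold bary cross
  fun_prop

variable [hq : Fact (IsEquilateral q)]

theorem bary_vertex (i j : Fin 3) : bary q i (q j) = if i = j then 1 else 0 := by
  have h := hq.out.cross_ne_zero
  unfold bary
  rw [div_eq_iff h]
  fin_cases i <;> fin_cases j <;> simp [cross] <;> ring

theorem sum_bary (x : Plane) : ∑ i, bary q i x = 1 := by
  have h := hq.out.cross_ne_zero
  unfold bary
  rw [← Finset.sum_div, div_eq_one_iff_eq h]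
  simp [cross, Fin.sum_univ_three]
  ring

theorem sum_bary_smul (x : Plane) : ∑ i, bary q i x • q i = x := by
  have h := hq.out.cross_ne_zero
  unfold bary
  have : ∑ i, (cross (q (i + 1) - x) (q (i + 2) - x) / cross (q 1 - q 0) (q 2 - q 0)) • q i
      = (cross (q 1 - q 0) (q 2 - q 0))⁻¹ •
        ∑ i, cross (q (i + 1) - x) (q (i + 2) - x) • q i := by
    rw [Finset.smul_sum]
    refine Finset.sum_congr rfl fun i _ => ?_
    rw [smul_smul, div_eq_inv_mul]
  rw [this, inv_smul_eq_iff₀ h]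
  ext k
  fin_cases k <;> simp [cross, Fin.sum_univ_three] <;> ring

theorem bary_contraction (i j : Fin 3) (x : Plane) :
    bary q i (contraction q j x) = (bary q i x + if i = j then 1 else 0) / 2 := by
  have h := hq.out.cross_ne_zero
  rw [← bary_vertex (q := q) i j]
  unfold bary
  rw [← add_div, div_div, div_eq_div_iff h (by simpa using h)]
  fin_cases i <;> fin_cases j <;> simp [cross, contraction] <;> ring

theorem bary_nonneg (i : Fin 3) (x : gasket q) : 0 ≤ bary q i x := by
  have := nonpos_of_comp_mapF_le (e := fun x : gasket q => -bary q i x)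
    ((continuous_bary i).comp continuous_subtype_val).neg (fun j y => by
      simp only [mapF, bary_contraction]
      split_ifs <;> linarith) x
  linarith

theorem bary_le_one (i : Fin 3) (x : gasket q) : bary q i x ≤ 1 := by
  rw [← sum_bary (q := q) (x : Plane)]
  exact Finset.single_le_sum (f := fun i => bary q i x) (fun j _ => bary_nonneg j x)
    (Finset.mem_univ i)

theorem eq_corner_of_bary_eq_one {i : Fin 3} {x : gasket q} (h : bary q i x = 1) :
    x = corner q i := by
  have h0 : ∀ j, j ≠ i → bary q j x = 0 := by
    intro j hj
    have h1 := sum_bary (q := q) (x : Plane)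
    rw [← Finset.add_sum_erase _ _ (Finset.mem_univ i), h] at h1
    have h2 : ∑ k ∈ Finset.univ.erase i, bary q k x = 0 := by linarith
    exact (Finset.sum_eq_zero_iff_of_nonneg fun k _ => bary_nonneg k x).1 h2 j (by simp [hj])
  apply Subtype.ext
  rw [← sum_bary_smul (q := q) (x : Plane), Finset.sum_eq_single i]
  · simp [h, corner]
  · intro j _ hj; simp [h0 j hj]
  · simp

theorem corner_injective : Function.Injective (corner q) := by
  intro i j h
  have h1 := bary_vertex (q := q) i j
  have h2 : q i = q j := congrArg Subtype.val h
  rw [← h2, bary_vertex] at h1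
  by_contra hij
  simp [hij] at h1

/-- Two cells of level one meet in at most one point, `F_i q_j = F_j q_i`. -/
theorem eq_corner_of_mapF_eq_mapF {i j : Fin 3} (hij : i ≠ j) {x y : gasket q}
    (h : mapF q i x = mapF q j y) : x = corner q j := by
  have h1 := congrArg (fun z : gasket q => bary q j z) h
  simp only [mapF, bary_contraction, hij.symm, if_true, if_false] at h1
  have h2 := bary_le_one j x
  have h3 := bary_nonneg j y
  exact eq_corner_of_bary_eq_one (by linarith)

/-- A corner is extreme: it lies in no cell of level one but its own. -/
theorem mapF_eq_corner {i j : Fin 3} {x : gasket q} (h : mapF q i x = corner q j) :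
    i = j ∧ x = corner q j := by
  have h1 := congrArg (fun z : gasket q => bary q j z) h
  simp only [mapF, corner, bary_contraction, bary_vertex, if_true] at h1
  have h2 := bary_le_one j x
  by_cases hij : j = i
  · subst hij
    simp only [if_true] at h1
    exact ⟨rfl, eq_corner_of_bary_eq_one (by linarith)⟩
  · simp only [hij, if_false] at h1
    linarith

end Geometry

section GraphLaplacian

variable {q : Fin 3 → Plane}

/-! ### Vertices, neighbours and the graph Laplacian -/

-- With these two facts `simp` evaluates the index `-(i + j)`, the one other than `i ≠ j`.
@[simp] theorem fin_three_neg_one : (-1 : Fin 3) = 2 := rfl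

@[simp] theorem fin_three_neg_two : (-2 : Fin 3) = 1 := rfl

theorem mem_vertices_zero {x : gasket q} : x ∈ vertices q 0 ↔ ∃ i, corner q i = x := by
  simp [vertices]

theorem mem_vertices_succ {m : ℕ} {x : gasket q} :
    x ∈ vertices q (m + 1) ↔ ∃ i, ∃ y ∈ vertices q m, mapF q i y = x := by
  simp [vertices]

theorem corner_mem_vertices (m : ℕ) (i : Fin 3) : corner q i ∈ vertices q m := by
  induction m with
  | zero => exact mem_vertices_zero.2 ⟨i, rfl⟩
  | succ m ih => exact mem_vertices_succ.2 ⟨i, _, ih, mapF_corner_self i⟩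

theorem vertices_subset_succ (m : ℕ) : vertices q m ⊆ vertices q (m + 1) := by
  induction m with
  | zero =>
    intro x hx
    obtain ⟨i, rfl⟩ := mem_vertices_zero.1 hx
    exact corner_mem_vertices 1 i
  | succ m ih =>
    intro x hx
    obtain ⟨i, y, hy, rfl⟩ := mem_vertices_succ.1 hx
    exact mem_vertices_succ.2 ⟨i, y, ih hy, rfl⟩

theorem vertices_mono : Monotone (vertices q) :=
  monotone_nat_of_le_succ vertices_subset_succ

theorem mapW_corner_mem_vertices (w : List (Fin 3)) (i : Fin 3) :
    mapW q w (corner q i) ∈ vertices q w.length := by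
  induction w with
  | nil => exact corner_mem_vertices 0 i
  | cons k w ih => exact mem_vertices_succ.2 ⟨k, _, ih, rfl⟩

theorem sameCell_zero (x y : gasket q) : SameCell q 0 x y :=
  ⟨[], rfl, ⟨x, rfl⟩, ⟨y, rfl⟩⟩

theorem sameCell_succ {m : ℕ} {x y : gasket q} :
    SameCell q (m + 1) x y ↔
      ∃ i x' y', SameCell q m x' y' ∧ mapF q i x' = x ∧ mapF q i y' = y := by
  constructor
  · rintro ⟨w, hw, ⟨x', rfl⟩, ⟨y', rfl⟩⟩
    obtain ⟨i, w, rfl⟩ := List.exists_of_length_succ w hw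
    exact ⟨i, _, _, ⟨w, by simpa using hw, ⟨x', rfl⟩, ⟨y', rfl⟩⟩, rfl, rfl⟩
  · rintro ⟨i, _, _, ⟨w, hw, ⟨x', rfl⟩, ⟨y', rfl⟩⟩, rfl, rfl⟩
    exact ⟨i :: w, by simp [hw], ⟨x', rfl⟩, ⟨y', rfl⟩⟩

theorem SameCell.symm {m : ℕ} {x y : gasket q} (h : SameCell q m x y) : SameCell q m y x := by
  obtain ⟨w, hw, hx, hy⟩ := h
  exact ⟨w, hw, hy, hx⟩

theorem mem_neighbors {m : ℕ} {x y : gasket q} :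
    y ∈ neighbors q m x ↔ y ∈ vertices q m ∧ y ≠ x ∧ SameCell q m x y := by
  simp [neighbors]

/-- The midpoint of the side opposite to the corner `q a`, that is the common point of the two cells
of level one other than the cell `a`. -/
noncomputable def midpoint (q : Fin 3 → Plane) (a : Fin 3) : gasket q :=
  mapF q (a + 1) (corner q (a + 2))

/-- For `i ≠ j` the remaining index is `-(i + j)`, because `0 + 1 + 2 = 0` in `Fin 3`. -/
theorem mapF_corner_eq_midpoint {i j : Fin 3} (hij : i ≠ j) :
    mapF q i (corner q j) = midpoint q (-(i + j)) := by
  unfold midpoint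
  revert hij
  fin_cases i <;> fin_cases j <;> simp <;> first | rfl | exact mapF_corner_comm _ _

/-- The interior vertices of level `m + 1` are the images of those of level `m` and the points
where two cells of level one meet. -/
theorem interior_vertex_cases {m : ℕ} {x : gasket q} (hx : x ∈ vertices q (m + 1))
    (hx0 : x ∉ vertices q 0) :
    (∃ i, ∃ y ∈ vertices q m, y ∉ vertices q 0 ∧ mapF q i y = x) ∨
      ∃ i j, i ≠ j ∧ mapF q i (corner q j) = x := by
  obtain ⟨i, y, hy, rfl⟩ := mem_vertices_succ.1 hx
  by_cases h : y ∈ vertices q 0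
  · obtain ⟨j, rfl⟩ := mem_vertices_zero.1 h
    refine Or.inr ⟨i, j, ?_, rfl⟩
    rintro rfl
    rw [mapF_corner_self] at hx0
    exact hx0 h
  · exact Or.inl ⟨i, y, hy, h, rfl⟩

theorem graphLaplacian_add (m : ℕ) (u v : gasket q → ℝ) (x : gasket q) :
    graphLaplacian q m (u + v) x = graphLaplacian q m u x + graphLaplacian q m v x := by
  unfold graphLaplacian
  rw [← Finset.sum_add_distrib]
  exact Finset.sum_congr rfl fun y _ => by simp only [Pi.add_apply]; ring

theorem graphLaplacian_smul (m : ℕ) (a : ℝ) (u : gasket q → ℝ) (x : gasket q) :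
    graphLaplacian q m (a • u) x = a * graphLaplacian q m u x := by
  unfold graphLaplacian
  rw [Finset.mul_sum]
  exact Finset.sum_congr rfl fun y _ => by simp only [Pi.smul_apply, smul_eq_mul]; ring

theorem continuous_of_comp_mapF {Y : Type*} [TopologicalSpace Y] {u : gasket q → Y}
    (h : ∀ i, Continuous (u ∘ mapF q i)) : Continuous u := by
  have hc : Continuous (fun p : Fin 3 × gasket q => mapF q p.1 p.2) :=
    continuous_prod_of_discrete_left.2 fun i => continuous_mapF i
  have hs : Function.Surjective (fun p : Fin 3 × gasket q => mapF q p.1 p.2) := fun x => by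
    obtain ⟨i, y, h⟩ := exists_mapF_eq x
    exact ⟨(i, y), h⟩
  rw [(hc.isClosedMap.isQuotientMap hc hs).continuous_iff]
  exact continuous_prod_of_discrete_left.2 h

variable [hq : Fact (IsEquilateral q)]

theorem mapF_mem_vertices_succ {m : ℕ} {i : Fin 3} {x : gasket q} :
    mapF q i x ∈ vertices q (m + 1) ↔ x ∈ vertices q m := by
  refine ⟨fun h => ?_, fun h => mem_vertices_succ.2 ⟨i, x, h, rfl⟩⟩
  obtain ⟨j, y, hy, hxy⟩ := mem_vertices_succ.1 h
  by_cases hij : i = j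
  · subst hij
    rwa [← mapF_injective i hxy]
  · rw [eq_corner_of_mapF_eq_mapF hij hxy.symm]
    exact corner_mem_vertices m j

theorem midpoint_notMem (a : Fin 3) : midpoint q a ∉ vertices q 0 := by
  intro h
  obtain ⟨j, hj⟩ := mem_vertices_zero.1 h
  obtain ⟨rfl, h2⟩ := mapF_eq_corner hj.symm
  have := corner_injective h2
  revert this
  fin_cases a <;> decide

/-- Away from the corners a point of a cell of level one lies in no other cell of level one. -/
theorem eq_of_mapF_eq_of_notMem {i j : Fin 3} {x y : gasket q} (hx : x ∉ vertices q 0)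
    (h : mapF q j y = mapF q i x) : j = i := by
  by_contra hij
  exact hx (mem_vertices_zero.2 ⟨j, (eq_corner_of_mapF_eq_mapF (Ne.symm hij) h.symm).symm⟩)

open scoped Classical in
theorem neighbors_mapF {m : ℕ} {i : Fin 3} {x : gasket q}
    (h : ∀ j y, mapF q j y = mapF q i x → j = i) :
    neighbors q (m + 1) (mapF q i x) = (neighbors q m x).image (mapF q i) := by
  ext y
  simp only [mem_neighbors, Finset.mem_image]
  constructor
  · rintro ⟨hy, hne, hc⟩
    obtain ⟨j, x', y', hc', hx, rfl⟩ := sameCell_succ.1 hc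
    obtain rfl := h j x' hx
    obtain rfl := mapF_injective j hx
    exact ⟨y', ⟨mapF_mem_vertices_succ.1 hy, fun h => hne (by rw [h]), hc'⟩, rfl⟩
  · rintro ⟨y', ⟨hy, hne, hc⟩, rfl⟩
    exact ⟨mapF_mem_vertices_succ.2 hy, fun h => hne (mapF_injective i h),
      sameCell_succ.2 ⟨i, _, _, hc, rfl, rfl⟩⟩

open scoped Classical in
theorem neighbors_junction {m : ℕ} {i j : Fin 3} (hij : i ≠ j) :
    neighbors q (m + 1) (mapF q i (corner q j)) =
      (neighbors q m (corner q j)).image (mapF q i) ∪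
        (neighbors q m (corner q i)).image (mapF q j) := by
  have key : ∀ {a b : Fin 3} {y' : gasket q}, mapF q a (corner q b) = mapF q i (corner q j) →
      y' ∈ neighbors q m (corner q b) →
      mapF q a y' ∈ neighbors q (m + 1) (mapF q i (corner q j)) := by
    intro a b y' hab hy
    obtain ⟨hy, hne, hc⟩ := mem_neighbors.1 hy
    rw [← hab]
    exact mem_neighbors.2 ⟨mapF_mem_vertices_succ.2 hy, fun h => hne (mapF_injective a h),
      sameCell_succ.2 ⟨a, _, _, hc, rfl, rfl⟩⟩
  ext y
  simp only [Finset.mem_union, Finset.mem_image]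
  constructor
  · intro h
    obtain ⟨hy, hne, hc⟩ := mem_neighbors.1 h
    obtain ⟨l, x', y', hc', hx, rfl⟩ := sameCell_succ.1 hc
    by_cases hl : l = i
    · subst hl
      obtain rfl := mapF_injective l hx
      exact Or.inl ⟨y', mem_neighbors.2 ⟨mapF_mem_vertices_succ.1 hy,
        fun h => hne (by rw [h]), hc'⟩, rfl⟩
    · have hjl : j = l := corner_injective (eq_corner_of_mapF_eq_mapF (Ne.symm hl) hx.symm)
      subst hjl
      rw [mapF_corner_comm] at hx hne
      obtain rfl := mapF_injective j hx
      exact Or.inr ⟨y', mem_neighbors.2 ⟨mapF_mem_vertices_succ.1 hy,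
        fun h => hne (by rw [h]), hc'⟩, rfl⟩
  · rintro (⟨y', hy, rfl⟩ | ⟨y', hy, rfl⟩)
    · exact key rfl hy
    · exact key (mapF_corner_comm _ _) hy

theorem graphLaplacian_mapF' {m : ℕ} {i : Fin 3} {x : gasket q} (u : gasket q → ℝ)
    (h : ∀ j y, mapF q j y = mapF q i x → j = i) :
    graphLaplacian q (m + 1) u (mapF q i x) = graphLaplacian q m (u ∘ mapF q i) x := by
  classical
  unfold graphLaplacian
  rw [neighbors_mapF h, Finset.sum_image fun a _ b _ h => mapF_injective i h]
  rfl

/-- The graph Laplacian at an interior vertex of the cell `i` only depends on this cell. -/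
theorem graphLaplacian_mapF {m : ℕ} (i : Fin 3) {x : gasket q} (hx : x ∉ vertices q 0)
    (u : gasket q → ℝ) :
    graphLaplacian q (m + 1) u (mapF q i x) = graphLaplacian q m (u ∘ mapF q i) x :=
  graphLaplacian_mapF' u fun _ _ h => eq_of_mapF_eq_of_notMem hx h

theorem graphLaplacian_corner_succ (m : ℕ) (i : Fin 3) (u : gasket q → ℝ) :
    graphLaplacian q (m + 1) u (corner q i) = graphLaplacian q m (u ∘ mapF q i) (corner q i) := by
  have h := graphLaplacian_mapF' (m := m) (i := i) (x := corner q i) u fun j y h => by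
    rw [mapF_corner_self] at h
    exact (mapF_eq_corner h).1
  rwa [mapF_corner_self] at h

theorem graphLaplacian_corner_zero (i : Fin 3) (u : gasket q → ℝ) :
    graphLaplacian q 0 u (corner q i) = ∑ k, (u (corner q k) - u (corner q i)) := by
  classical
  unfold graphLaplacian
  have : neighbors q 0 (corner q i) = (Finset.univ.erase i).image (corner q) := by
    ext y
    simp only [mem_neighbors, mem_vertices_zero, Finset.mem_image, Finset.mem_erase,
      Finset.mem_univ, and_true]
    constructor
    · rintro ⟨⟨k, rfl⟩, hne, -⟩
      exact ⟨k, fun h => hne (by rw [h]), rfl⟩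
    · rintro ⟨k, hk, rfl⟩
      exact ⟨⟨k, rfl⟩, fun h => hk (corner_injective h), sameCell_zero _ _⟩
  rw [this, Finset.sum_image fun a _ b _ h => corner_injective h,
    ← Finset.add_sum_erase _ _ (Finset.mem_univ i)]
  simp

theorem graphLaplacian_corner (m : ℕ) (i : Fin 3) (u : gasket q → ℝ) :
    graphLaplacian q m u (corner q i) =
      ∑ k, (u ((mapF q i)^[m] (corner q k)) - u (corner q i)) := by
  induction m generalizing u with
  | zero => exact graphLaplacian_corner_zero i u
  | succ m ih =>
    rw [graphLaplacian_corner_succ, ih]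
    simp only [Function.comp, mapF_corner_self, ← Function.iterate_succ_apply']

/-- Where two cells meet, both contribute to the graph Laplacian. -/
theorem graphLaplacian_junction (m : ℕ) {i j : Fin 3} (hij : i ≠ j) (u : gasket q → ℝ) :
    graphLaplacian q (m + 1) u (mapF q i (corner q j)) =
      graphLaplacian q m (u ∘ mapF q i) (corner q j) +
        graphLaplacian q m (u ∘ mapF q j) (corner q i) := by
  classical
  unfold graphLaplacian
  rw [neighbors_junction hij, Finset.sum_union,
    Finset.sum_image fun a _ b _ h => mapF_injective i h,
    Finset.sum_image fun a _ b _ h => mapF_injective j h]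
  · simp only [Function.comp, mapF_corner_comm j i]
  · rw [Finset.disjoint_left]
    intro y h1 h2
    obtain ⟨a, ha, rfl⟩ := Finset.mem_image.1 h1
    obtain ⟨b, hb, hab⟩ := Finset.mem_image.1 h2
    exact (mem_neighbors.1 ha).2.1 (eq_corner_of_mapF_eq_mapF hij hab.symm)

/-! ### Gluing functions on the three cells of level one -/

/-- The function on the gasket that is `g i` on the cell `i`, meaningful if the `g i` agree where
the cells meet. -/
noncomputable def glue (q : Fin 3 → Plane) (g : Fin 3 → gasket q → ℝ) (x : gasket q) : ℝ :=
  g (exists_mapF_eq x).choose (exists_mapF_eq x).choose_spec.choose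

theorem glue_mapF {g : Fin 3 → gasket q → ℝ}
    (hg : ∀ i j, g i (corner q j) = g j (corner q i)) (i : Fin 3) (x : gasket q) :
    glue q g (mapF q i x) = g i x := by
  have key : ∀ j y, mapF q j y = mapF q i x → g j y = g i x := by
    intro j y hy
    by_cases hij : i = j
    · subst hij
      rw [mapF_injective i hy]
    · rw [eq_corner_of_mapF_eq_mapF hij hy.symm, eq_corner_of_mapF_eq_mapF (Ne.symm hij) hy, hg]
  exact key _ _ (exists_mapF_eq (mapF q i x)).choose_spec.choose_spec

theorem continuous_glue {g : Fin 3 → gasket q → ℝ}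
    (hg : ∀ i j, g i (corner q j) = g j (corner q i)) (hc : ∀ i, Continuous (g i)) :
    Continuous (glue q g) :=
  continuous_of_comp_mapF fun i => by
    rw [show glue q g ∘ mapF q i = g i from funext (glue_mapF hg i)]
    exact hc i

/-! ### The symmetries of the gasket -/

/-- The affine map of the plane that permutes the vertices `q i`. -/
noncomputable def permPlane (q : Fin 3 → Plane) (σ : Equiv.Perm (Fin 3)) (x : Plane) : Plane :=
  ∑ i, bary q i x • q (σ i)

theorem permPlane_contraction (σ : Equiv.Perm (Fin 3)) (j : Fin 3) (x : Plane) :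
    permPlane q σ (contraction q j x) = contraction q (σ j) (permPlane q σ x) := by
  have h : ∀ i, bary q i (contraction q j x) • q (σ i)
      = (1 / 2 : ℝ) • bary q i x • q (σ i) + (if i = j then (1 / 2 : ℝ) • q (σ i) else 0) := by
    intro i
    rw [bary_contraction]
    split_ifs <;> module
  unfold permPlane
  rw [Finset.sum_congr rfl fun i _ => h i, Finset.sum_add_distrib, ← Finset.smul_sum]
  simp only [Finset.sum_ite_eq', Finset.mem_univ, if_true]
  rw [contraction]
  module

theorem permPlane_mem (σ : Equiv.Perm (Fin 3)) (x : gasket q) :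
    permPlane q σ x ∈ gasket q := by
  have hc : Continuous (permPlane q σ) := by
    unfold permPlane
    exact continuous_finsetSum _ fun i _ => (continuous_bary i).smul continuous_const
  have h := nonpos_of_comp_mapF_le
    (e := fun x : gasket q => Metric.infDist (permPlane q σ x) (gasket q))
    ((Metric.continuous_infDist_pt _).comp (hc.comp continuous_subtype_val)) (fun j y => by
      obtain ⟨z, hz, hyz⟩ :=
        (isCompact_gasket q).exists_infDist_eq_dist (gasket_nonempty q) (permPlane q σ y)
      simp only [mapF, permPlane_contraction, hyz]
      refine (Metric.infDist_le_dist_of_mem (contraction_mem q (σ j) hz)).trans ?_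
      simp only [contraction, dist_add_right]
      rw [dist_smul₀, dist_sub_right]
      norm_num) x
  exact ((isCompact_gasket q).isClosed.mem_iff_infDist_zero (gasket_nonempty q)).2
    (le_antisymm h Metric.infDist_nonneg)

/-- The symmetry of the gasket that permutes the corners. -/
noncomputable def perm (q : Fin 3 → Plane) [Fact (IsEquilateral q)] (σ : Equiv.Perm (Fin 3))
    (x : gasket q) : gasket q :=
  ⟨permPlane q σ x, permPlane_mem σ x⟩

theorem continuous_perm (σ : Equiv.Perm (Fin 3)) : Continuous (perm q σ) := by
  have hc : Continuous (permPlane q σ) := by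
    unfold permPlane
    exact continuous_finsetSum _ fun i _ => (continuous_bary i).smul continuous_const
  exact (hc.comp continuous_subtype_val).subtype_mk _

theorem perm_mapF (σ : Equiv.Perm (Fin 3)) (i : Fin 3) (x : gasket q) :
    perm q σ (mapF q i x) = mapF q (σ i) (perm q σ x) :=
  Subtype.ext (permPlane_contraction σ i x)

theorem perm_corner (σ : Equiv.Perm (Fin 3)) (i : Fin 3) :
    perm q σ (corner q i) = corner q (σ i) :=
  Subtype.ext (by simp [perm, corner, permPlane, bary_vertex])

theorem perm_perm (σ τ : Equiv.Perm (Fin 3)) (x : gasket q) :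
    perm q σ (perm q τ x) = perm q (σ * τ) x := by
  have h := nonpos_of_comp_mapF_le
    (e := fun x : gasket q => dist (perm q σ (perm q τ x)) (perm q (σ * τ) x))
    (((continuous_perm σ).comp (continuous_perm τ)).dist (continuous_perm _)) (fun j y => by
      rw [perm_mapF, perm_mapF, perm_mapF]
      have := dist_mapW [σ (τ j)] (perm q σ (perm q τ y)) (perm q (σ * τ) y)
      simpa [mapW] using this.le) x
  exact dist_le_zero.1 h

theorem perm_one (x : gasket q) : perm q 1 x = x :=
  Subtype.ext (sum_bary_smul (x : Plane))

theorem perm_injective (σ : Equiv.Perm (Fin 3)) : Function.Injective (perm q σ) := by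
  intro x y h
  have := congrArg (perm q σ⁻¹) h
  simpa [perm_perm, perm_one] using this

theorem perm_mem_vertices {σ : Equiv.Perm (Fin 3)} {m : ℕ} {x : gasket q}
    (h : x ∈ vertices q m) : perm q σ x ∈ vertices q m := by
  induction m generalizing x with
  | zero =>
    obtain ⟨i, rfl⟩ := mem_vertices_zero.1 h
    exact mem_vertices_zero.2 ⟨σ i, (perm_corner σ i).symm⟩
  | succ m ih =>
    obtain ⟨i, y, hy, rfl⟩ := mem_vertices_succ.1 h
    exact mem_vertices_succ.2 ⟨σ i, _, ih hy, (perm_mapF σ i y).symm⟩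

theorem perm_mem_vertices_iff {σ : Equiv.Perm (Fin 3)} {m : ℕ} {x : gasket q} :
    perm q σ x ∈ vertices q m ↔ x ∈ vertices q m := by
  refine ⟨fun h => ?_, perm_mem_vertices⟩
  simpa [perm_perm, perm_one] using perm_mem_vertices (σ := σ⁻¹) h

theorem SameCell.perm {σ : Equiv.Perm (Fin 3)} {m : ℕ} {x y : gasket q}
    (h : SameCell q m x y) : SameCell q m (perm q σ x) (perm q σ y) := by
  induction m generalizing x y with
  | zero => exact sameCell_zero _ _
  | succ m ih =>
    obtain ⟨i, x', y', h', rfl, rfl⟩ := sameCell_succ.1 h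
    exact sameCell_succ.2 ⟨σ i, _, _, ih h', (perm_mapF σ i x').symm, (perm_mapF σ i y').symm⟩

theorem graphLaplacian_comp_perm (σ : Equiv.Perm (Fin 3)) (m : ℕ) (u : gasket q → ℝ)
    (x : gasket q) :
    graphLaplacian q m (u ∘ perm q σ) x = graphLaplacian q m u (perm q σ x) := by
  unfold graphLaplacian
  refine Finset.sum_bij' (fun y _ => perm q σ y) (fun y _ => perm q σ⁻¹ y) ?_ ?_ ?_ ?_ ?_
  · intro y hy
    obtain ⟨h1, h2, h3⟩ := mem_neighbors.1 hy
    exact mem_neighbors.2 ⟨perm_mem_vertices h1, fun h => h2 (perm_injective σ h), h3.perm⟩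
  · intro y hy
    obtain ⟨h1, h2, h3⟩ := mem_neighbors.1 hy
    refine mem_neighbors.2 ⟨perm_mem_vertices h1, fun h => h2 ?_, ?_⟩
    · rw [← h]; simp [perm_perm, perm_one]
    · simpa [perm_perm, perm_one] using h3.perm (σ := σ⁻¹)
  · intro y _; simp [perm_perm, perm_one]
  · intro y _; simp [perm_perm, perm_one]
  · intro y _; rfl

end GraphLaplacian

section Harmonic

variable {q : Fin 3 → Plane}

/-! ### Elementary properties of the Laplacian -/

theorem HasLaplacian.add {u v f g : gasket q → ℝ} (hu : HasLaplacian q u f)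
    (hv : HasLaplacian q v g) : HasLaplacian q (u + v) (f + g) := by
  refine ⟨hu.1.add hv.1, hu.2.1.add hv.2.1, fun ε hε => ?_⟩
  obtain ⟨N, hN⟩ := hu.2.2 (ε / 2) (by positivity)
  obtain ⟨M, hM⟩ := hv.2.2 (ε / 2) (by positivity)
  refine ⟨max N M, fun m hm x hx hx0 => ?_⟩
  have h1 := hN m (le_of_max_le_left hm) x hx hx0
  have h2 := hM m (le_of_max_le_right hm) x hx hx0
  rw [graphLaplacian_add, Pi.add_apply]
  rw [abs_lt] at *
  constructor <;> linarith

theorem HasLaplacian.smul {u f : gasket q → ℝ} (a : ℝ) (hu : HasLaplacian q u f) :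
    HasLaplacian q (a • u) (a • f) := by
  refine ⟨hu.1.const_smul a, hu.2.1.const_smul a, fun ε hε => ?_⟩
  obtain ⟨N, hN⟩ := hu.2.2 (ε / (|a| + 1)) (by positivity)
  refine ⟨N, fun m hm x hx hx0 => ?_⟩
  have h1 := hN m hm x hx hx0
  rw [lt_div_iff₀ (by positivity)] at h1
  rw [graphLaplacian_smul, Pi.smul_apply, smul_eq_mul,
    show 3 / 2 * 5 ^ m * (a * graphLaplacian q m u x) - a * f x
      = a * (3 / 2 * 5 ^ m * graphLaplacian q m u x - f x) by ring, abs_mul]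
  nlinarith [abs_nonneg a, abs_nonneg (3 / 2 * 5 ^ m * graphLaplacian q m u x - f x)]

theorem HasLaplacian.sub {u v f g : gasket q → ℝ} (hu : HasLaplacian q u f)
    (hv : HasLaplacian q v g) : HasLaplacian q (u - v) (f - g) := by
  have := hu.add (hv.smul (-1))
  simpa [sub_eq_add_neg] using this

/-- The images of a point under the maps `F_w` are dense. -/
theorem eq_zero_of_forall_mapW {u : gasket q → ℝ} (hu : Continuous u) (z : gasket q)
    (h : ∀ w, u (mapW q w z) = 0) : u = 0 := by
  funext x
  refine abs_eq_zero.1 (le_antisymm (le_of_forall_pos_lt_add fun ε hε => ?_) (abs_nonneg _))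
  obtain ⟨N, hN⟩ := exists_oscillation_lt hu hε
  obtain ⟨w, y, hw, rfl⟩ := exists_mapW_eq N x
  have := hN w hw.ge y z
  rw [h, sub_zero] at this
  simpa using this

variable [hq : Fact (IsEquilateral q)]

theorem HasLaplacian.comp_perm {u f : gasket q → ℝ} (hu : HasLaplacian q u f)
    (σ : Equiv.Perm (Fin 3)) : HasLaplacian q (u ∘ perm q σ) (f ∘ perm q σ) := by
  refine ⟨hu.1.comp (continuous_perm σ), hu.2.1.comp (continuous_perm σ), fun ε hε => ?_⟩
  obtain ⟨N, hN⟩ := hu.2.2 ε hε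
  refine ⟨N, fun m hm x hx hx0 => ?_⟩
  rw [graphLaplacian_comp_perm]
  exact hN m hm _ (perm_mem_vertices hx) fun h => hx0 (perm_mem_vertices_iff.1 h)

theorem mapW_midpoint_mem (w : List (Fin 3)) (a : Fin 3) :
    mapW q w (midpoint q a) ∈ vertices q (w.length + 1) ∧
      mapW q w (midpoint q a) ∉ vertices q 0 := by
  induction w with
  | nil => exact ⟨mapF_mem_vertices_succ.2 (corner_mem_vertices 0 _), midpoint_notMem a⟩
  | cons i w ih =>
    refine ⟨mapF_mem_vertices_succ.2 ih.1, fun h => ?_⟩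
    obtain ⟨j, hj⟩ := mem_vertices_zero.1 h
    exact ih.2 (mem_vertices_zero.2 ⟨j, (mapF_eq_corner hj.symm).2.symm⟩)

/-- `Δ u` is determined by `u`, since the interior vertices are dense. -/
theorem HasLaplacian.unique {u f g : gasket q → ℝ} (hf : HasLaplacian q u f)
    (hg : HasLaplacian q u g) : f = g := by
  refine sub_eq_zero.1 (eq_zero_of_forall_mapW (hf.2.1.sub hg.2.1) (midpoint q 0) fun w => ?_)
  obtain ⟨h1, h2⟩ := mapW_midpoint_mem w (0 : Fin 3) (q := q)
  refine abs_eq_zero.1 (le_antisymm (le_of_forall_pos_lt_add fun ε hε => ?_) (abs_nonneg _))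
  obtain ⟨N, hN⟩ := hf.2.2 (ε / 2) (by positivity)
  obtain ⟨M, hM⟩ := hg.2.2 (ε / 2) (by positivity)
  have hm : w.length + 1 ≤ max (w.length + 1) (max N M) := le_max_left _ _
  have h3 := hN (max (w.length + 1) (max N M)) (by omega) _ (vertices_mono hm h1) h2
  have h4 := hM (max (w.length + 1) (max N M)) (by omega) _ (vertices_mono hm h1) h2
  rw [Pi.sub_apply]
  rw [abs_lt] at *
  constructor <;> linarith

/-! ### Harmonic functions -/

/-- The harmonic extension rule: the values at the corners of the cell `i` of the harmonic function
with the values `a j` at the corners `q j`. -/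
noncomputable def harmStep (i : Fin 3) (a : Fin 3 → ℝ) (j : Fin 3) : ℝ :=
  if j = i then a i else (2 * a i + 2 * a j + a (-(i + j))) / 5

theorem harmStep_self (i : Fin 3) (a : Fin 3 → ℝ) : harmStep i a i = a i := by simp [harmStep]

theorem harmStep_comm (i j : Fin 3) (a : Fin 3 → ℝ) : harmStep i a j = harmStep j a i := by
  unfold harmStep
  by_cases h : j = i
  · simp [h]
  · rw [if_neg h, if_neg (Ne.symm h), add_comm i j]; ring

theorem harmStep_mem {a : Fin 3 → ℝ} {lo hi : ℝ} (h : ∀ j, a j ∈ Set.Icc lo hi) (i j : Fin 3) :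
    harmStep i a j ∈ Set.Icc lo hi := by
  unfold harmStep
  split_ifs
  · exact h i
  · have h1 := h i
    have h2 := h j
    have h3 := h (-(i + j))
    simp only [Set.mem_Icc] at *
    constructor <;> linarith

/-- The extension rule contracts oscillations by the factor `3 / 5`. -/
theorem harmStep_oscillation {a : Fin 3 → ℝ} {C : ℝ} (h : ∀ j k, a j - a k ≤ C) (i j k : Fin 3) :
    harmStep i a j - harmStep i a k ≤ 3 / 5 * C := by
  have h01 := h 0 1
  have h10 := h 1 0
  have h12 := h 1 2
  have h21 := h 2 1
  have h02 := h 0 2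
  have h20 := h 2 0
  fin_cases i <;> fin_cases j <;> fin_cases k <;> simp [harmStep] <;>
    linarith

/-- Approximations of the harmonic function with the values `a j` at the corners: the function that
is affine on the cells of level `m` and follows the harmonic extension rule down to there. -/
noncomputable def harmSeq (q : Fin 3 → Plane) : ℕ → (Fin 3 → ℝ) → gasket q → ℝ
  | 0, a => fun x => ∑ i, a i * bary q i x
  | m + 1, a => glue q fun i => harmSeq q m (harmStep i a)

theorem harmSeq_corner (m : ℕ) (a : Fin 3 → ℝ) (j : Fin 3) :
    harmSeq q m a (corner q j) = a j := by
  induction m generalizing a j with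
  | zero => simp [harmSeq, corner, bary_vertex]
  | succ m ih =>
    have := glue_mapF (q := q) (g := fun i => harmSeq q m (harmStep i a)) (fun i j => by
      rw [ih, ih, harmStep_comm]) j (corner q j)
    rw [mapF_corner_self] at this
    rw [harmSeq, this, ih, harmStep_self]

theorem harmSeq_succ_mapF (m : ℕ) (a : Fin 3 → ℝ) (i : Fin 3) (x : gasket q) :
    harmSeq q (m + 1) a (mapF q i x) = harmSeq q m (harmStep i a) x :=
  glue_mapF (g := fun i => harmSeq q m (harmStep i a)) (fun i j => by
    rw [harmSeq_corner, harmSeq_corner, harmStep_comm]) i x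

theorem continuous_harmSeq (m : ℕ) (a : Fin 3 → ℝ) : Continuous (harmSeq q m a) := by
  induction m generalizing a with
  | zero =>
    exact continuous_finsetSum _ fun i _ =>
      continuous_const.mul ((continuous_bary i).comp continuous_subtype_val)
  | succ m ih =>
    exact continuous_glue (fun i j => by rw [harmSeq_corner, harmSeq_corner, harmStep_comm])
      fun i => ih _

theorem harmSeq_mem (m : ℕ) {a : Fin 3 → ℝ} {lo hi : ℝ} (h : ∀ j, a j ∈ Set.Icc lo hi)
    (x : gasket q) : harmSeq q m a x ∈ Set.Icc lo hi := by
  induction m generalizing a x with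
  | zero =>
    have h0 := sum_bary (q := q) (x : Plane)
    constructor
    · calc lo = ∑ i, lo * bary q i x := by rw [← Finset.mul_sum, h0, mul_one]
        _ ≤ _ := Finset.sum_le_sum fun i _ =>
          mul_le_mul_of_nonneg_right (h i).1 (bary_nonneg i x)
    · calc _ ≤ ∑ i, hi * bary q i x := Finset.sum_le_sum fun i _ =>
          mul_le_mul_of_nonneg_right (h i).2 (bary_nonneg i x)
        _ = hi := by rw [← Finset.mul_sum, h0, mul_one]
  | succ m ih =>
    obtain ⟨i, y, rfl⟩ := exists_mapF_eq x
    rw [harmSeq_succ_mapF]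
    exact ih (harmStep_mem h i) y

theorem harmSeq_add (m : ℕ) (a b : Fin 3 → ℝ) (x : gasket q) :
    harmSeq q m (a + b) x = harmSeq q m a x + harmSeq q m b x := by
  induction m generalizing a b x with
  | zero => simp [harmSeq, add_mul, Finset.sum_add_distrib]
  | succ m ih =>
    obtain ⟨i, y, rfl⟩ := exists_mapF_eq x
    simp only [harmSeq_succ_mapF, ← ih]
    congr 1
    funext j
    simp only [harmStep, Pi.add_apply]
    split_ifs <;> ring

theorem harmSeq_smul (m : ℕ) (c : ℝ) (a : Fin 3 → ℝ) (x : gasket q) :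
    harmSeq q m (c • a) x = c * harmSeq q m a x := by
  induction m generalizing a x with
  | zero => simp [harmSeq, mul_assoc, Finset.mul_sum]
  | succ m ih =>
    obtain ⟨i, y, rfl⟩ := exists_mapF_eq x
    simp only [harmSeq_succ_mapF, ← ih]
    congr 1
    funext j
    simp only [harmStep, Pi.smul_apply, smul_eq_mul]
    split_ifs <;> ring

theorem dist_harmSeq_le (m : ℕ) {a : Fin 3 → ℝ} {C : ℝ} (h : ∀ j k, a j - a k ≤ C)
    (x : gasket q) : dist (harmSeq q m a x) (harmSeq q (m + 1) a x) ≤ 2 * C * (3 / 5) ^ m := by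
  induction m generalizing a C x with
  | zero =>
    have h1 : ∀ j, a j ∈ Set.Icc (a 0 - C) (a 0 + C) := fun j =>
      ⟨by linarith [h 0 j], by linarith [h j 0]⟩
    have h2 := harmSeq_mem 0 h1 x
    have h3 := harmSeq_mem 1 h1 x
    rw [Real.dist_eq, abs_le]
    simp only [Set.mem_Icc] at h2 h3
    constructor <;> linarith
  | succ m ih =>
    obtain ⟨i, y, rfl⟩ := exists_mapF_eq x
    rw [harmSeq_succ_mapF, harmSeq_succ_mapF]
    refine (ih (harmStep_oscillation h i) y).trans (le_of_eq ?_)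
    ring

/-- The harmonic function with the values `a j` at the corners `q j`. -/
noncomputable def harm (q : Fin 3 → Plane) (a : Fin 3 → ℝ) (x : gasket q) : ℝ :=
  limUnder atTop fun m => harmSeq q m a x

theorem exists_oscillation_bound (a : Fin 3 → ℝ) : ∃ C, ∀ j k, a j - a k ≤ C :=
  ⟨∑ j, ∑ k, |a j - a k|, fun j k =>
    (le_abs_self _).trans <|
      (Finset.single_le_sum (f := fun k => |a j - a k|) (fun _ _ => abs_nonneg _)
        (Finset.mem_univ k)).trans <|
      Finset.single_le_sum (f := fun j => ∑ k, |a j - a k|)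
        (fun _ _ => Finset.sum_nonneg fun _ _ => abs_nonneg _) (Finset.mem_univ j)⟩

theorem tendsto_harmSeq (a : Fin 3 → ℝ) (x : gasket q) :
    Tendsto (fun m => harmSeq q m a x) atTop (𝓝 (harm q a x)) := by
  obtain ⟨C, hC⟩ := exists_oscillation_bound a
  exact (cauchySeq_of_le_geometric (3 / 5) (2 * C) (by norm_num) fun m =>
    dist_harmSeq_le m hC x).tendsto_limUnder

theorem continuous_harm (a : Fin 3 → ℝ) : Continuous (harm q a) := by
  obtain ⟨C, hC⟩ := exists_oscillation_bound a
  have hu : TendstoUniformly (fun m => harmSeq q m a) (harm q a) atTop := by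
    rw [Metric.tendstoUniformly_iff]
    intro ε hε
    have ht : Tendsto (fun m : ℕ => 2 * C * (3 / 5 : ℝ) ^ m / (1 - 3 / 5)) atTop (𝓝 0) := by
      have := ((tendsto_pow_atTop_nhds_zero_of_lt_one (by norm_num : (0 : ℝ) ≤ 3 / 5)
        (by norm_num)).const_mul (2 * C)).div_const (1 - 3 / 5)
      simpa using this
    filter_upwards [ht.eventually_lt_const hε] with m hm x
    rw [dist_comm]
    exact (dist_le_of_le_geometric_of_tendsto (3 / 5) (2 * C) (by norm_num)
      (fun m => dist_harmSeq_le m hC x) (tendsto_harmSeq a x) m).trans_lt hm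
  exact hu.continuous (Frequently.of_forall fun m => continuous_harmSeq m a)

@[simp] theorem harm_corner (a : Fin 3 → ℝ) (j : Fin 3) : harm q a (corner q j) = a j :=
  tendsto_nhds_unique (tendsto_harmSeq a _) (by simp [harmSeq_corner])

theorem harm_mapF (a : Fin 3 → ℝ) (i : Fin 3) (x : gasket q) :
    harm q a (mapF q i x) = harm q (harmStep i a) x := by
  refine tendsto_nhds_unique ((tendsto_add_atTop_iff_nat 1).2 (tendsto_harmSeq a _)) ?_
  simpa only [harmSeq_succ_mapF] using tendsto_harmSeq (harmStep i a) x

theorem harm_comp_mapF (a : Fin 3 → ℝ) (i : Fin 3) :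
    harm q a ∘ mapF q i = harm q (harmStep i a) :=
  funext (harm_mapF a i)

theorem harm_mem {a : Fin 3 → ℝ} {lo hi : ℝ} (h : ∀ j, a j ∈ Set.Icc lo hi) (x : gasket q) :
    harm q a x ∈ Set.Icc lo hi :=
  isClosed_Icc.mem_of_tendsto (tendsto_harmSeq a x)
    (Eventually.of_forall fun m => harmSeq_mem m h x)

theorem harm_add (a b : Fin 3 → ℝ) (x : gasket q) :
    harm q (a + b) x = harm q a x + harm q b x :=
  tendsto_nhds_unique (tendsto_harmSeq _ x)
    (by simpa only [harmSeq_add] using (tendsto_harmSeq a x).add (tendsto_harmSeq b x))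

theorem harm_smul (c : ℝ) (a : Fin 3 → ℝ) (x : gasket q) :
    harm q (c • a) x = c * harm q a x :=
  tendsto_nhds_unique (tendsto_harmSeq _ x)
    (by simpa only [harmSeq_smul] using (tendsto_harmSeq a x).const_mul c)

/-- The harmonic function that is one at the corner `q j` and zero at the other two. -/
noncomputable def harmBasis (q : Fin 3 → Plane) (j : Fin 3) : gasket q → ℝ :=
  harm q (Pi.single j 1)

theorem harm_eq_sum (a : Fin 3 → ℝ) (x : gasket q) :
    harm q a x = ∑ j, a j * harmBasis q j x := by
  have h : a = a 0 • Pi.single 0 1 + a 1 • Pi.single 1 1 + a 2 • Pi.single 2 1 := by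
    funext j
    fin_cases j <;> simp
  conv_lhs => rw [h]
  rw [harm_add, harm_add, harm_smul, harm_smul, harm_smul, Fin.sum_univ_three]
  rfl

theorem continuous_harmBasis (j : Fin 3) : Continuous (harmBasis q j) := continuous_harm _

theorem harmBasis_corner (j k : Fin 3) :
    harmBasis q j (corner q k) = if k = j then 1 else 0 := by
  simp [harmBasis, Pi.single_apply]

theorem harmBasis_mapF (j i : Fin 3) (x : gasket q) :
    harmBasis q j (mapF q i x) = ∑ k, harmStep i (Pi.single j 1) k * harmBasis q k x := by
  rw [harmBasis, harm_mapF, harm_eq_sum]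

theorem harmBasis_nonneg (j : Fin 3) (x : gasket q) : 0 ≤ harmBasis q j x :=
  (harm_mem (lo := 0) (hi := 1) (fun k => by
    rw [Pi.single_apply]; split_ifs <;> simp) x).1

theorem sum_harmBasis (x : gasket q) : ∑ j, harmBasis q j x = 1 := by
  have h := harm_mem (q := q) (a := 1) (lo := 1) (hi := 1) (by simp) x
  rw [Set.Icc_self, Set.mem_singleton_iff, harm_eq_sum] at h
  simpa using h

theorem harm_eq_zero (x : gasket q) : harm q 0 x = 0 := by simp [harm_eq_sum]

/-- The renormalization factor `3 / 5`: the graph Laplacian of a harmonic function at a corner. -/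
theorem graphLaplacian_harm_corner (m : ℕ) (a : Fin 3 → ℝ) (i : Fin 3) :
    graphLaplacian q m (harm q a) (corner q i) = (3 / 5) ^ m * ∑ k, (a k - a i) := by
  induction m generalizing a with
  | zero => simp [graphLaplacian_corner_zero]
  | succ m ih =>
    rw [graphLaplacian_corner_succ, harm_comp_mapF, ih, pow_succ, mul_assoc]
    congr 1
    fin_cases i <;> simp [harmStep, Fin.sum_univ_three] <;> ring

/-- At the points where two cells meet the contributions of the two cells cancel. -/
theorem graphLaplacian_harm (m : ℕ) (a : Fin 3 → ℝ) {x : gasket q} (hx : x ∈ vertices q m)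
    (hx0 : x ∉ vertices q 0) : graphLaplacian q m (harm q a) x = 0 := by
  induction m generalizing a x with
  | zero => exact absurd hx hx0
  | succ m ih =>
    rcases interior_vertex_cases hx hx0 with ⟨i, y, hy, hy0, rfl⟩ | ⟨i, j, hij, rfl⟩
    · rw [graphLaplacian_mapF i hy0, harm_comp_mapF]
      exact ih _ hy hy0
    · rw [graphLaplacian_junction m hij, harm_comp_mapF, harm_comp_mapF,
        graphLaplacian_harm_corner, graphLaplacian_harm_corner, ← mul_add]
      refine mul_eq_zero_of_right _ ?_
      revert hij
      fin_cases i <;> fin_cases j <;> simp [harmStep, Fin.sum_univ_three] <;> ring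

theorem hasLaplacian_harm (a : Fin 3 → ℝ) : HasLaplacian q (harm q a) 0 :=
  ⟨continuous_harm a, continuous_const, fun ε hε => ⟨0, fun m _ x hx hx0 => by
    simpa [graphLaplacian_harm m a hx hx0] using hε⟩⟩

/-- The normal derivative is the renormalized limit of the graph Laplacians at the corner. -/
theorem hasNormalDeriv_iff {u : gasket q → ℝ} {i : Fin 3} {a : ℝ} :
    HasNormalDeriv q u i a ↔
      Tendsto (fun m : ℕ => -((5 / 3 : ℝ) ^ m * graphLaplacian q m u (corner q i))) atTop
        (𝓝 a) := by
  unfold HasNormalDeriv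
  refine tendsto_congr fun m => ?_
  rw [graphLaplacian_corner, ← mul_neg]
  congr 1
  have h : (mapF q i)^[m] (corner q i) = corner q i := Function.iterate_fixed (mapF_corner_self i) m
  fin_cases i <;> simp [Fin.sum_univ_three] at h ⊢ <;> rw [h] <;> ring

theorem hasNormalDeriv_harm (a : Fin 3 → ℝ) (i : Fin 3) :
    HasNormalDeriv q (harm q a) i (2 * a i - a (i + 1) - a (i - 1)) := by
  rw [hasNormalDeriv_iff]
  refine tendsto_const_nhds.congr fun m => ?_
  rw [graphLaplacian_harm_corner, ← mul_assoc, ← mul_pow]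
  norm_num
  fin_cases i <;> simp [Fin.sum_univ_three] <;> ring

theorem hasTangentialDeriv_harm (a : Fin 3 → ℝ) (i : Fin 3) :
    HasTangentialDeriv q (harm q a) i (a (i + 1) - a (i - 1)) := by
  unfold HasTangentialDeriv
  refine tendsto_const_nhds.congr fun m => ?_
  induction m generalizing a with
  | zero => simp
  | succ m ih =>
    rw [Function.iterate_succ_apply', Function.iterate_succ_apply', harm_mapF, harm_mapF, pow_succ,
      mul_right_comm, ← ih]
    fin_cases i <;> simp [harmStep] <;> ring

end Harmonic

section Measure

variable {q : Fin 3 → Plane}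

/-! ### Self-similarity of the measure -/

/-- The address `i ω₀ ω₁ …`. -/
def consAddress (i : Fin 3) (ω : ℕ → Fin 3) (k : ℕ) : Fin 3 := Nat.casesOn k i ω

theorem measurable_consAddress (i : Fin 3) : Measurable (consAddress i) := by
  refine measurable_pi_iff.2 fun k => ?_
  cases k with
  | zero => exact measurable_const
  | succ k => exact measurable_pi_apply k

instance : IsProbabilityMeasure fairMeasure := by
  unfold fairMeasure; infer_instance

open scoped ENNReal in
/-- The first letter of a random address is uniform and independent of the rest, which is again a
random address. -/
theorem fairMeasure_eq_sum :
    fairMeasure = (3 : ℝ≥0∞)⁻¹ • ∑ i, fairMeasure.map (consAddress i) := by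
  refine (Measure.eq_infinitePi _ fun s t ht => ?_).symm
  classical
  obtain ⟨N, hN⟩ := s.exists_nat_subset_range
  -- Pad the box by full factors, so that it is indexed by an initial segment.
  set t' : ℕ → Set (Fin 3) := fun k => if k ∈ s then t k else Set.univ with ht'
  have hbox : Set.pi s t = Set.pi (Finset.range (N + 1)) t' := by
    ext ω
    simp only [Set.mem_pi, Finset.mem_coe, ht']
    constructor
    · intro h k _
      split_ifs with hk
      · exact h k hk
      · trivial
    · intro h k hk
      have := h k (Finset.mem_range.2 ((Finset.mem_range.1 (hN hk)).trans (Nat.lt_succ_self N)))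
      rwa [if_pos hk] at this
  have hprod : ∏ k ∈ s, (PMF.uniformOfFintype (Fin 3)).toMeasure (t k)
      = ∏ k ∈ Finset.range (N + 1), (PMF.uniformOfFintype (Fin 3)).toMeasure (t' k) := by
    rw [← Finset.prod_subset (hN.trans (Finset.range_subset_range.2 (Nat.le_succ N)))]
    · exact Finset.prod_congr rfl fun k hk => by simp [ht', hk]
    · intro k _ hk
      simp [ht', hk]
  have hpre : ∀ i, fairMeasure.map (consAddress i) (Set.pi (Finset.range (N + 1)) t')
      = (t' 0).indicator 1 i *
        ∏ k ∈ Finset.range N, (PMF.uniformOfFintype (Fin 3)).toMeasure (t' (k + 1)) := by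
    intro i
    rw [Measure.map_apply (measurable_consAddress i)
      (MeasurableSet.pi (Finset.countable_toSet _) fun k _ => (Set.toFinite _).measurableSet)]
    have : consAddress i ⁻¹' Set.pi (Finset.range (N + 1)) t'
        = if i ∈ t' 0 then Set.pi (Finset.range N) (fun k => t' (k + 1)) else ∅ := by
      ext ω
      simp only [Set.mem_preimage, Set.mem_pi, Finset.mem_coe, Finset.mem_range]
      split_ifs with hi
      · simp only [Set.mem_pi, Finset.mem_coe, Finset.mem_range]
        constructor
        · intro h k hk
          exact h (k + 1) (by omega)
        · intro h k hk
          cases k with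
          | zero => exact hi
          | succ k => exact h k (by omega)
      · exact ⟨fun h => hi (h 0 (by omega)), fun h => h.elim⟩
    rw [this]
    split_ifs with hi
    · rw [fairMeasure, Measure.infinitePi_pi _ fun k _ => (Set.toFinite _).measurableSet]
      simp [hi]
    · simp [hi]
  rw [hprod, hbox, Finset.prod_range_succ', Measure.smul_apply, Measure.finsetSum_apply,
    Finset.sum_congr rfl fun i _ => hpre i, ← Finset.sum_mul, smul_eq_mul, ← mul_assoc, mul_comm,
    PMF.toMeasure_apply_fintype, Finset.mul_sum]
  congr 1
  refine Finset.sum_congr rfl fun i _ => ?_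
  by_cases hi : i ∈ t' 0 <;> simp [hi]

/-- The point of the gasket with a given address. -/
noncomputable def addressPoint (q : Fin 3 → Plane) (ω : ℕ → Fin 3) : gasket q :=
  ⟨address q ω, ω, rfl⟩

theorem continuous_addressPoint : Continuous (addressPoint q) :=
  (continuous_address q).subtype_mk _

theorem addressPoint_cons (i : Fin 3) (ω : ℕ → Fin 3) :
    addressPoint q (consAddress i ω) = mapF q i (addressPoint q ω) :=
  Subtype.ext (contraction_address q (consAddress i ω)).symm

instance : IsProbabilityMeasure (mu q) :=
  Measure.isProbabilityMeasure_map continuous_addressPoint.measurable.aemeasurable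

theorem integrable_of_continuous {X : Type*} [TopologicalSpace X] [CompactSpace X]
    [MeasurableSpace X] [OpensMeasurableSpace X] {u : X → ℝ} (hu : Continuous u) (ν : Measure X)
    [IsFiniteMeasure ν] : Integrable u ν :=
  hu.integrable_of_hasCompactSupport (HasCompactSupport.of_compactSpace u)

theorem integral_mu {u : gasket q → ℝ} (hu : Continuous u) :
    ∫ x, u x ∂(mu q) = ∫ ω, u (addressPoint q ω) ∂fairMeasure :=
  integral_map continuous_addressPoint.measurable.aemeasurable
    (integrable_of_continuous hu (mu q)).aestronglyMeasurable

/-- The integral is the mean of the integrals over the cells of level one. -/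
theorem integral_self_similar {u : gasket q → ℝ} (hu : Continuous u) :
    ∫ x, u x ∂(mu q) = 1 / 3 * ∑ i, ∫ x, u (mapF q i x) ∂(mu q) := by
  have hi : ∀ i, Integrable (fun ω => u (addressPoint q ω)) (fairMeasure.map (consAddress i)) :=
    fun i =>
      have := Measure.isProbabilityMeasure_map (μ := fairMeasure)
        (measurable_consAddress i).aemeasurable
      integrable_of_continuous (hu.comp continuous_addressPoint) _
  rw [integral_mu hu]
  conv_lhs => rw [fairMeasure_eq_sum]
  rw [integral_smul_measure, integral_finsetSum_measure fun i _ => hi i]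
  simp only [ENNReal.toReal_inv, ENNReal.toReal_ofNat, smul_eq_mul, one_div]
  congr 1
  refine Finset.sum_congr rfl fun i _ => ?_
  rw [integral_map (measurable_consAddress i).aemeasurable (hi i).aestronglyMeasurable]
  simp only [addressPoint_cons]
  exact (integral_mu (hu.comp (continuous_mapF i))).symm

/-- A cell of level `m` has mass at least `3 ^ (-m)`. -/
theorem le_integral_of_mapW {u : gasket q → ℝ} (hu : Continuous u) (h0 : ∀ x, 0 ≤ u x)
    {ε : ℝ} (w : List (Fin 3)) (h : ∀ x, ε ≤ u (mapW q w x)) :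
    (1 / 3) ^ w.length * ε ≤ ∫ x, u x ∂(mu q) := by
  induction w generalizing u with
  | nil =>
    have := integral_mono (integrable_const ε) (integrable_of_continuous hu (mu q)) h
    simpa using this
  | cons i w ih =>
    rw [integral_self_similar hu, List.length_cons, pow_succ', mul_assoc]
    refine mul_le_mul_of_nonneg_left ?_ (by norm_num)
    refine (ih (hu.comp (continuous_mapF i)) (fun x => h0 _) h).trans ?_
    exact Finset.single_le_sum (f := fun i => ∫ x, u (mapF q i x) ∂(mu q))
      (fun j _ => integral_nonneg fun x => h0 _) (Finset.mem_univ i)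

/-- The measure charges every cell, so that a nonnegative continuous function with integral zero
vanishes. -/
theorem integral_pos_of_ne_zero {u : gasket q → ℝ} (hu : Continuous u) (h0 : ∀ x, 0 ≤ u x)
    (h : u ≠ 0) : 0 < ∫ x, u x ∂(mu q) := by
  obtain ⟨x, hx⟩ := Function.ne_iff.1 h
  have hx' : 0 < u x := lt_of_le_of_ne (h0 x) (Ne.symm hx)
  obtain ⟨N, hN⟩ := exists_oscillation_lt hu (half_pos hx')
  obtain ⟨w, y, hw, hy⟩ := exists_mapW_eq N x
  refine lt_of_lt_of_le (by positivity : 0 < (1 / 3 : ℝ) ^ w.length * (u x / 2))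
    (le_integral_of_mapW hu h0 w fun z => ?_)
  have := hN w hw.ge y z
  rw [hy, abs_lt] at this
  linarith

/-- The inner product of `L²`, as a bilinear form on the continuous functions. -/
noncomputable def ipForm (q : Fin 3 → Plane) : C(gasket q, ℝ) →ₗ[ℝ] C(gasket q, ℝ) →ₗ[ℝ] ℝ :=
  LinearMap.mk₂ ℝ (fun u v => ip q u v)
    (fun u u' v => by
      simp only [ip, ContinuousMap.add_apply, add_mul]
      exact integral_add (integrable_of_continuous (u.continuous.fun_mul v.continuous) _)
        (integrable_of_continuous (u'.continuous.fun_mul v.continuous) _))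
    (fun c u v => by
      simp only [ip, ContinuousMap.smul_apply, smul_eq_mul, mul_assoc, integral_const_mul])
    (fun u v v' => by
      simp only [ip, ContinuousMap.add_apply, mul_add]
      exact integral_add (integrable_of_continuous (u.continuous.fun_mul v.continuous) _)
        (integrable_of_continuous (u.continuous.fun_mul v'.continuous) _))
    (fun c u v => by
      simp only [ip, ContinuousMap.smul_apply, smul_eq_mul, mul_left_comm _ c, integral_const_mul])

theorem ipForm_apply (u v : C(gasket q, ℝ)) : ipForm q u v = ip q u v := rfl

theorem ip_comm (u v : gasket q → ℝ) : ip q u v = ip q v u := by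
  simp only [ip, mul_comm]

theorem ipForm_self_pos {u : C(gasket q, ℝ)} (hu : u ≠ 0) : 0 < ipForm q u u :=
  integral_pos_of_ne_zero (u.continuous.fun_mul u.continuous) (fun _ => mul_self_nonneg _)
    fun h => hu (ContinuousMap.ext fun x => mul_self_eq_zero.1 (congrFun h x))

theorem normL2_sq (u : gasket q → ℝ) : normL2 q u ^ 2 = ip q u u := by
  unfold normL2 ip
  rw [Real.sq_sqrt (integral_nonneg fun x => sq_nonneg _)]
  simp only [sq]

variable [hq : Fact (IsEquilateral q)]

/-- By self-similarity these integrals solve a linear system with the unique solution `1 / 3`. -/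
theorem integral_harmBasis (j : Fin 3) : ∫ x, harmBasis q j x ∂(mu q) = 1 / 3 := by
  have hint : ∀ k, Integrable (harmBasis q k) (mu q) := fun k =>
    integrable_of_continuous (continuous_harmBasis k) _
  have hsum : ∑ k, ∫ x, harmBasis q k x ∂(mu q) = 1 := by
    rw [← integral_finsetSum _ fun k _ => hint k]
    simp [sum_harmBasis]
  have h := integral_self_similar (continuous_harmBasis (q := q) j)
  simp only [harmBasis_mapF] at h
  simp only [integral_finsetSum Finset.univ fun k _ => (hint k).const_mul _,
    integral_const_mul] at h
  rw [Fin.sum_univ_three] at hsum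
  revert h
  fin_cases j <;> simp [Fin.sum_univ_three, harmStep, Pi.single_apply] <;> intro h <;> linarith

end Measure

section GreenKernel

variable {q : Fin 3 → Plane}

/-! ### Piecewise harmonic interpolation -/

/-- The function that is harmonic on the cells of level `m` and agrees with `φ` on `V_m`. -/
noncomputable def interp (q : Fin 3 → Plane) : ℕ → (gasket q → ℝ) → gasket q → ℝ
  | 0, φ => harm q fun j => φ (corner q j)
  | m + 1, φ => glue q fun i => interp q m (φ ∘ mapF q i)

open scoped Classical in
/-- The candidate for the spline `ψ_z^{(m)}`, for which all its properties are proved directly. -/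
noncomputable def hat (q : Fin 3 → Plane) (m : ℕ) (z : gasket q) : gasket q → ℝ :=
  interp q m fun x => if x = z then 1 else 0

/-- The piecewise harmonic spline of level one that peaks at the midpoint `a`. -/
noncomputable def tent (q : Fin 3 → Plane) (a : Fin 3) : gasket q → ℝ := hat q 1 (midpoint q a)

/-- The coefficients `g(z, z')` of level zero, indexed by midpoints. -/
noncomputable def midCoeff (a b : Fin 3) : ℝ := if a = b then 9 / 50 else 3 / 50

/-- The term of index `m` of the series that defines the Green function. -/
noncomputable def greenTerm (q : Fin 3 → Plane) (m : ℕ) (x y : gasket q) : ℝ := by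
  classical exact
  ∑ z ∈ vertices q (m + 1) \ vertices q m, ∑ z' ∈ vertices q (m + 1) \ vertices q m,
    greenCoeff q m z z' * hat q (m + 1) z x * hat q (m + 1) z' y

/-- The sum of the series of the `greenTerm`s; it is shown to be the Green function `green` once
the splines are known to be unique. -/
noncomputable def greenSeries (q : Fin 3 → Plane) (x y : gasket q) : ℝ :=
  ∑' m, greenTerm q m x y

theorem greenCoeff_symm (m : ℕ) (z z' : gasket q) : greenCoeff q m z z' = greenCoeff q m z' z := by
  classical
  by_cases h : z = z'
  · rw [h]
  · unfold greenCoeff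
    rw [if_neg h, if_neg (Ne.symm h)]
    exact if_congr ⟨SameCell.symm, SameCell.symm⟩ rfl rfl

theorem greenTerm_symm (m : ℕ) (x y : gasket q) : greenTerm q m x y = greenTerm q m y x := by
  unfold greenTerm
  rw [Finset.sum_comm]
  refine Finset.sum_congr rfl fun z _ => Finset.sum_congr rfl fun z' _ => ?_
  rw [greenCoeff_symm]
  ring

theorem greenSeries_symm (x y : gasket q) : greenSeries q x y = greenSeries q y x :=
  tsum_congr fun m => greenTerm_symm m x y

variable [hq : Fact (IsEquilateral q)]

theorem interp_corner (m : ℕ) (φ : gasket q → ℝ) (j : Fin 3) :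
    interp q m φ (corner q j) = φ (corner q j) := by
  induction m generalizing φ j with
  | zero => simp [interp]
  | succ m ih =>
    have := glue_mapF (q := q) (g := fun i => interp q m (φ ∘ mapF q i)) (fun i j => by
      rw [ih, ih, Function.comp, Function.comp, mapF_corner_comm]) j (corner q j)
    rw [mapF_corner_self] at this
    rw [interp, this, ih, Function.comp, mapF_corner_self]

theorem interp_succ_comp_mapF (m : ℕ) (φ : gasket q → ℝ) (i : Fin 3) :
    interp q (m + 1) φ ∘ mapF q i = interp q m (φ ∘ mapF q i) :=
  funext <| glue_mapF (g := fun i => interp q m (φ ∘ mapF q i)) (fun i j => by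
    rw [interp_corner, interp_corner, Function.comp, Function.comp, mapF_corner_comm]) i

theorem interp_succ_mapF (m : ℕ) (φ : gasket q → ℝ) (i : Fin 3) (x : gasket q) :
    interp q (m + 1) φ (mapF q i x) = interp q m (φ ∘ mapF q i) x :=
  congrFun (interp_succ_comp_mapF m φ i) x

theorem continuous_interp (m : ℕ) (φ : gasket q → ℝ) : Continuous (interp q m φ) := by
  induction m generalizing φ with
  | zero => exact continuous_harm _
  | succ m ih =>
    refine continuous_of_comp_mapF fun i => ?_
    rw [interp_succ_comp_mapF]
    exact ih _

theorem interp_vertex {m : ℕ} (φ : gasket q → ℝ) {x : gasket q} (hx : x ∈ vertices q m) :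
    interp q m φ x = φ x := by
  induction m generalizing φ x with
  | zero =>
    obtain ⟨j, rfl⟩ := mem_vertices_zero.1 hx
    exact interp_corner 0 φ j
  | succ m ih =>
    obtain ⟨i, y, hy, rfl⟩ := mem_vertices_succ.1 hx
    rw [interp_succ_mapF, ih _ hy, Function.comp]

theorem interp_comp_mapW (w : List (Fin 3)) (φ : gasket q → ℝ) :
    interp q w.length φ ∘ mapW q w = harm q fun j => φ (mapW q w (corner q j)) := by
  induction w generalizing φ with
  | nil => rfl
  | cons i w ih =>
    rw [List.length_cons, mapW, ← Function.comp_assoc, interp_succ_comp_mapF, ih]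
    rfl

theorem interp_zero (m : ℕ) (x : gasket q) : interp q m (fun _ => 0) x = 0 := by
  induction m generalizing x with
  | zero => exact harm_eq_zero x
  | succ m ih =>
    obtain ⟨i, y, rfl⟩ := exists_mapF_eq x
    rw [interp_succ_mapF]
    exact ih y

theorem continuous_hat (m : ℕ) (z : gasket q) : Continuous (hat q m z) := continuous_interp _ _

theorem hat_vertex {m : ℕ} (z : gasket q) {x : gasket q} (hx : x ∈ vertices q m) :
    hat q m z x = by classical exact if x = z then 1 else 0 :=
  interp_vertex _ hx

/-- The spline that peaks at a point `F_k z` inside the cell `k` lives on this cell, where it is a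
copy of the spline of the previous level. -/
theorem hat_succ_mapF {m : ℕ} {k : Fin 3} {z : gasket q} (hz : z ∉ vertices q 0) (i : Fin 3)
    (x : gasket q) :
    hat q (m + 1) (mapF q k z) (mapF q i x) = if k = i then hat q m z x else 0 := by
  unfold hat
  rw [interp_succ_mapF]
  split_ifs with h
  · subst h
    simp only [Function.comp_def, mapF_inj]
  · have : ((fun x => if x = mapF q k z then 1 else 0) ∘ mapF q i : gasket q → ℝ) = fun _ => 0 := by
      funext y
      simp only [Function.comp, ite_eq_right_iff]
      intro hy
      exact absurd (eq_of_mapF_eq_of_notMem hz hy) (Ne.symm h)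
    rw [this, interp_zero]

theorem neg_add_ne {i a : Fin 3} (h : i ≠ a) : i ≠ -(a + i) ∧ -(i + -(a + i)) = a := by
  revert i a; decide

theorem continuous_tent (a : Fin 3) : Continuous (tent q a) := continuous_hat _ _

theorem tent_mapF (a i : Fin 3) (x : gasket q) :
    tent q a (mapF q i x) = if i = a then 0 else harmBasis q (-(a + i)) x := by
  unfold tent hat
  rw [interp_succ_mapF, interp, harm_eq_sum]
  have h1 : ∀ j, mapF q i (corner q j) = midpoint q a ↔ i ≠ a ∧ j = -(a + i) := by
    intro j
    constructor
    · intro h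
      by_cases hi : i = a + 1
      · subst hi
        have := corner_injective (mapF_injective _ h)
        subst this
        clear h
        revert a
        decide
      · have h2 := corner_injective (eq_corner_of_mapF_eq_mapF hi h)
        have h3 := corner_injective (eq_corner_of_mapF_eq_mapF (Ne.symm hi) h.symm)
        revert h2 h3
        clear h hi
        revert a i j
        decide
    · rintro ⟨hi, rfl⟩
      obtain ⟨h1, h2⟩ := neg_add_ne hi
      rw [mapF_corner_eq_midpoint h1, h2]
  simp only [Function.comp, h1]
  split_ifs with hi
  · simp [hi]
  · simp [hi]

theorem mem_new_succ {m : ℕ} {i : Fin 3} {z : gasket q} :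
    (mapF q i z ∈ vertices q (m + 2) ∧ mapF q i z ∉ vertices q (m + 1)) ↔
      z ∈ vertices q (m + 1) ∧ z ∉ vertices q m := by
  rw [mapF_mem_vertices_succ, mapF_mem_vertices_succ]

open scoped Classical in
/-- The vertices that are new at level `m + 2` are the images of those new at level `m + 1`. -/
theorem sum_new_succ (m : ℕ) (F : gasket q → ℝ) :
    ∑ z ∈ vertices q (m + 2) \ vertices q (m + 1), F z =
      ∑ i, ∑ z ∈ vertices q (m + 1) \ vertices q m, F (mapF q i z) := by
  have h : vertices q (m + 2) \ vertices q (m + 1) =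
      Finset.univ.biUnion fun i => (vertices q (m + 1) \ vertices q m).image (mapF q i) := by
    ext z
    simp only [Finset.mem_sdiff, Finset.mem_biUnion, Finset.mem_univ, true_and, Finset.mem_image]
    constructor
    · intro hz
      obtain ⟨i, y, hy, rfl⟩ := mem_vertices_succ.1 hz.1
      exact ⟨i, y, mem_new_succ.1 hz, rfl⟩
    · rintro ⟨i, y, hy, rfl⟩
      exact mem_new_succ.2 hy
  rw [h, Finset.sum_biUnion]
  · exact Finset.sum_congr rfl fun i _ =>
      Finset.sum_image fun a _ b _ hab => mapF_injective i hab
  · intro i _ j _ hij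
    rw [Function.onFun, Finset.disjoint_left]
    intro z hz hz'
    obtain ⟨a, ha, rfl⟩ := Finset.mem_image.1 hz
    obtain ⟨b, hb, hab⟩ := Finset.mem_image.1 hz'
    refine hij (eq_of_mapF_eq_of_notMem (fun h => ?_) hab).symm
    exact (Finset.mem_sdiff.1 ha).2 (vertices_mono (Nat.zero_le m) h)

theorem midpoint_injective : Function.Injective (midpoint q) := by
  intro a b h
  have h1 := tent_mapF (q := q) a (a + 1) (corner q (a + 2))
  have h2 := tent_mapF (q := q) b (a + 1) (corner q (a + 2))
  change tent q a (midpoint q a) = _ at h1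
  change tent q b (midpoint q a) = _ at h2
  have h3 : tent q b = tent q a := by unfold tent; rw [h]
  rw [h3, h1] at h2
  revert h2
  simp only [harmBasis_corner]
  revert a b
  intro a b _ _
  fin_cases a <;> fin_cases b <;> simp

open scoped Classical in
theorem sum_new_zero (F : gasket q → ℝ) :
    ∑ z ∈ vertices q 1 \ vertices q 0, F z = ∑ a, F (midpoint q a) := by
  have h : vertices q 1 \ vertices q 0 = Finset.univ.image (midpoint q) := by
    ext z
    simp only [Finset.mem_sdiff, Finset.mem_univ, true_and, Finset.mem_image]
    constructor
    · rintro ⟨h1, h0⟩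
      rcases interior_vertex_cases h1 h0 with ⟨i, y, hy, hy0, rfl⟩ | ⟨i, j, hij, rfl⟩
      · exact absurd hy hy0
      · exact ⟨_, (mapF_corner_eq_midpoint hij).symm⟩
    · rintro ⟨a, rfl⟩
      exact ⟨mapF_mem_vertices_succ.2 (corner_mem_vertices 0 _), midpoint_notMem a⟩
  rw [h, Finset.sum_image fun a _ b _ hab => midpoint_injective hab]

theorem greenCoeff_midpoint (a b : Fin 3) :
    greenCoeff q 0 (midpoint q a) (midpoint q b) = midCoeff a b := by
  unfold greenCoeff midCoeff
  simp only [midpoint_injective.eq_iff, pow_zero, mul_one]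
  by_cases hab : a = b
  · simp [hab]
  · rw [if_neg hab, if_neg hab, if_pos]
    obtain ⟨h1, h2⟩ := neg_add_ne hab
    obtain ⟨h3, h4⟩ := neg_add_ne (Ne.symm hab)
    refine sameCell_succ.2 ⟨-(a + b), corner q b, corner q a, sameCell_zero _ _, ?_, ?_⟩
    · rw [mapF_corner_eq_midpoint h3.symm, add_comm _ b, h4]
    · rw [add_comm a b, mapF_corner_eq_midpoint h1.symm, add_comm _ a, h2]

theorem greenCoeff_succ (m : ℕ) (i j : Fin 3) {z z' : gasket q} (hz : z ∉ vertices q 0)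
    (hz' : z' ∉ vertices q 0) :
    greenCoeff q (m + 1) (mapF q i z) (mapF q j z') =
      if i = j then 3 / 5 * greenCoeff q m z z' else 0 := by
  have hcell : SameCell q (m + 1 + 1) (mapF q i z) (mapF q j z') ↔
      i = j ∧ SameCell q (m + 1) z z' := by
    rw [sameCell_succ]
    constructor
    · rintro ⟨k, x', y', h, h1, h2⟩
      obtain rfl := eq_of_mapF_eq_of_notMem hz h1
      obtain rfl := eq_of_mapF_eq_of_notMem hz' h2
      rw [← mapF_injective _ h1, ← mapF_injective _ h2]
      exact ⟨rfl, h⟩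
    · rintro ⟨rfl, h⟩
      exact ⟨i, z, z', h, rfl, rfl⟩
  classical
  unfold greenCoeff
  by_cases hij : i = j
  · subst hij
    rw [if_pos rfl, if_congr mapF_inj rfl (if_congr (hcell.trans (and_iff_right rfl)) rfl rfl)]
    split_ifs <;> ring
  · rw [if_neg hij, if_neg fun h => hij (eq_of_mapF_eq_of_notMem hz' h),
      if_neg fun h => hij (hcell.1 h).1]

theorem greenTerm_zero (x y : gasket q) :
    greenTerm q 0 x y = ∑ a, ∑ b, midCoeff a b * tent q a x * tent q b y := by
  unfold greenTerm
  simp only [Nat.zero_add, sum_new_zero, greenCoeff_midpoint]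
  rfl

/-- Each term of the Green series is a copy of the previous one on the diagonal cells, and zero off
them. -/
theorem greenTerm_succ (m : ℕ) (i j : Fin 3) (x y : gasket q) :
    greenTerm q (m + 1) (mapF q i x) (mapF q j y) =
      if i = j then 3 / 5 * greenTerm q m x y else 0 := by
  classical
  have hnew : ∀ z ∈ vertices q (m + 1) \ vertices q m, z ∉ vertices q 0 := fun z hz h =>
    (Finset.mem_sdiff.1 hz).2 (vertices_mono (Nat.zero_le m) h)
  unfold greenTerm
  simp only [sum_new_succ]
  -- Only the splines that peak in the cells `i` and `j` do not vanish at the two points.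
  rw [Finset.sum_eq_single i _ (by simp)]
  · have h : ∀ z ∈ vertices q (m + 1) \ vertices q m,
        (∑ l, ∑ z' ∈ vertices q (m + 1) \ vertices q m,
          greenCoeff q (m + 1) (mapF q i z) (mapF q l z') *
            hat q (m + 1 + 1) (mapF q i z) (mapF q i x) *
            hat q (m + 1 + 1) (mapF q l z') (mapF q j y))
        = ∑ z' ∈ vertices q (m + 1) \ vertices q m,
          (if i = j then 3 / 5 * greenCoeff q m z z' else 0) * hat q (m + 1) z x *
            hat q (m + 1) z' y := by
      intro z hz
      rw [Finset.sum_eq_single j _ (by simp)]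
      · refine Finset.sum_congr rfl fun z' hz' => ?_
        rw [greenCoeff_succ m i j (hnew z hz) (hnew z' hz'), hat_succ_mapF (hnew z hz),
          hat_succ_mapF (hnew z' hz'), if_pos rfl, if_pos rfl]
      · intro l _ hl
        refine Finset.sum_eq_zero fun z' hz' => ?_
        rw [hat_succ_mapF (hnew z' hz') j, if_neg hl, mul_zero]
    rw [Finset.sum_congr rfl h]
    split_ifs
    · simp only [Finset.mul_sum, mul_assoc]
    · simp
  · intro k _ hk
    refine Finset.sum_eq_zero fun z hz => Finset.sum_eq_zero fun l _ =>
      Finset.sum_eq_zero fun z' _ => ?_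
    rw [hat_succ_mapF (hnew z hz) i, if_neg hk, mul_zero, zero_mul]

/-- The Green function vanishes on the boundary, as all peaks are off `V_0`. -/
theorem greenTerm_corner (m : ℕ) (i : Fin 3) (y : gasket q) :
    greenTerm q m (corner q i) y = 0 := by
  unfold greenTerm
  refine Finset.sum_eq_zero fun z hz => Finset.sum_eq_zero fun z' _ => ?_
  rw [hat_vertex z (corner_mem_vertices (m + 1) i), if_neg, mul_zero, zero_mul]
  rintro rfl
  exact (Finset.mem_sdiff.1 hz).2 (corner_mem_vertices m i)

theorem continuous_greenTerm (m : ℕ) :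
    Continuous fun p : gasket q × gasket q => greenTerm q m p.1 p.2 := by
  unfold greenTerm
  refine continuous_finsetSum _ fun z _ => continuous_finsetSum _ fun z' _ => ?_
  exact (continuous_const.mul ((continuous_hat _ z).comp continuous_fst)).mul
    ((continuous_hat _ z').comp continuous_snd)

theorem exists_greenTerm_bound (q : Fin 3 → Plane) [Fact (IsEquilateral q)] :
    ∃ C, ∀ m (x y : gasket q), |greenTerm q m x y| ≤ C * (3 / 5) ^ m := by
  obtain ⟨C, hC⟩ := isCompact_univ.exists_bound_of_continuousOn
    (continuous_greenTerm (q := q) 0).continuousOn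
  refine ⟨C, fun m => ?_⟩
  have hC0 : 0 ≤ C := (norm_nonneg _).trans (hC (corner q 0, corner q 0) (Set.mem_univ _))
  induction m with
  | zero => intro x y; simpa using hC (x, y) (Set.mem_univ _)
  | succ m ih =>
    intro x y
    obtain ⟨i, x', rfl⟩ := exists_mapF_eq x
    obtain ⟨j, y', rfl⟩ := exists_mapF_eq y
    rw [greenTerm_succ]
    split_ifs
    · rw [abs_mul, abs_of_pos (by norm_num : (0 : ℝ) < 3 / 5), pow_succ]
      linarith [ih x' y']
    · simp only [abs_zero]; positivity

theorem summable_greenTerm (x y : gasket q) : Summable fun m => greenTerm q m x y := by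
  obtain ⟨C, hC⟩ := exists_greenTerm_bound q
  exact Summable.of_norm_bounded
    ((summable_geometric_of_lt_one (by norm_num) (by norm_num : (3 / 5 : ℝ) < 1)).mul_left C)
    fun m => hC m x y

theorem continuous_greenSeries :
    Continuous fun p : gasket q × gasket q => greenSeries q p.1 p.2 := by
  obtain ⟨C, hC⟩ := exists_greenTerm_bound q
  exact continuous_tsum continuous_greenTerm
    ((summable_geometric_of_lt_one (by norm_num) (by norm_num : (3 / 5 : ℝ) < 1)).mul_left C)
    fun m p => hC m p.1 p.2

theorem greenSeries_corner (i : Fin 3) (y : gasket q) : greenSeries q (corner q i) y = 0 := by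
  simp [greenSeries, greenTerm_corner]

/-- The self-similarity of the Green function. -/
theorem greenSeries_mapF (i j : Fin 3) (x y : gasket q) :
    greenSeries q (mapF q i x) (mapF q j y) =
      greenTerm q 0 (mapF q i x) (mapF q j y) + if i = j then 3 / 5 * greenSeries q x y else 0 := by
  unfold greenSeries
  rw [(summable_greenTerm _ _).tsum_eq_zero_add]
  simp only [greenTerm_succ]
  split_ifs
  · rw [tsum_mul_left]
  · rw [tsum_zero]

end GreenKernel

section GreenOperator

variable {q : Fin 3 → Plane}

/-! ### The Green operator inverts the Laplacian -/

/-- The solution `-∫ G(x, y) p(y) dμ(y)` of the Dirichlet problem `Δ u = p`, `u = 0` on `V_0`. -/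
noncomputable def potential (q : Fin 3 → Plane) (p : gasket q → ℝ) (x : gasket q) : ℝ :=
  -∫ y, greenSeries q x y * p y ∂(mu q)

/-- The integral of `p` against the harmonic function that is one at `q j` and zero at the other
corners. -/
noncomputable def moment (q : Fin 3 → Plane) (p : gasket q → ℝ) (j : Fin 3) : ℝ :=
  ∫ x, harmBasis q j x * p x ∂(mu q)

theorem mapW_replicate (m : ℕ) (j : Fin 3) (x : gasket q) :
    mapW q (List.replicate m j) x = (mapF q j)^[m] x := by
  induction m with
  | zero => rfl
  | succ m ih => rw [Function.iterate_succ_apply', ← ih]; rfl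

variable [hq : Fact (IsEquilateral q)]

theorem continuous_greenSeries_right (x : gasket q) : Continuous (greenSeries q x) :=
  Continuous.comp (f := fun y => (x, y)) (continuous_greenSeries (q := q))
    (Continuous.prodMk_right x)

theorem continuous_potential {p : gasket q → ℝ} (hp : Continuous p) :
    Continuous (potential q p) := by
  have h := continuous_parametric_integral_of_continuous (μ := mu q)
    (f := fun x y => greenSeries q x y * p y)
    (continuous_greenSeries.mul (hp.comp continuous_snd)) isCompact_univ
  simp only [Measure.restrict_univ] at h
  exact h.neg

theorem potential_corner (p : gasket q → ℝ) (i : Fin 3) : potential q p (corner q i) = 0 := by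
  simp [potential, greenSeries_corner]

theorem tent_midpoint (a b : Fin 3) : tent q a (midpoint q b) = if b = a then 1 else 0 := by
  unfold tent
  rw [hat_vertex (m := 1) (x := midpoint q b) _ (mapW_midpoint_mem [] b).1]
  simp only [midpoint_injective.eq_iff]

theorem integral_tent_mul {p : gasket q → ℝ} (hp : Continuous p) (b : Fin 3) :
    ∫ y, tent q b y * p y ∂(mu q) =
      1 / 3 * ∑ i, if i = b then 0 else moment q (p ∘ mapF q i) (-(b + i)) := by
  rw [integral_self_similar ((continuous_tent b).fun_mul hp)]
  congr 1
  refine Finset.sum_congr rfl fun i _ => ?_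
  simp only [tent_mapF]
  split_ifs <;> simp [moment]

theorem moment_self_similar {p : gasket q → ℝ} (hp : Continuous p) (j : Fin 3) :
    moment q p j =
      1 / 3 * ∑ i, ∑ k, harmStep i (Pi.single j 1) k * moment q (p ∘ mapF q i) k := by
  unfold moment
  rw [integral_self_similar ((continuous_harmBasis j).fun_mul hp)]
  congr 1
  refine Finset.sum_congr rfl fun i _ => ?_
  simp only [harmBasis_mapF, Finset.sum_mul, mul_assoc, Function.comp]
  have hp' : Continuous fun x => p (mapF q i x) := hp.comp (continuous_mapF i)
  rw [integral_finsetSum _ fun k _ => integrable_of_continuous (continuous_const.fun_mul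
    ((continuous_harmBasis k).fun_mul hp')) _]
  simp only [integral_const_mul]

theorem potential_mapF_eq_sum {p : gasket q → ℝ} (hp : Continuous p) (i : Fin 3) (x : gasket q) :
    potential q p (mapF q i x) =
      -(∑ a, ∑ b, midCoeff a b * tent q a (mapF q i x) * ∫ y, tent q b y * p y ∂(mu q)) +
        1 / 5 * potential q (p ∘ mapF q i) x := by
  have hc : Continuous fun y => greenTerm q 0 (mapF q i x) y :=
    Continuous.comp (f := fun y => (mapF q i x, y)) (continuous_greenTerm (q := q) 0)
      (Continuous.prodMk_right _)
  have hint : ∀ {u : gasket q → ℝ}, Continuous u → Integrable u (mu q) := fun h =>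
    integrable_of_continuous h _
  have h0 : ∫ y, greenTerm q 0 (mapF q i x) y * p y ∂(mu q) =
      ∑ a, ∑ b, midCoeff a b * tent q a (mapF q i x) * ∫ y, tent q b y * p y ∂(mu q) := by
    simp only [greenTerm_zero, Finset.sum_mul, mul_assoc]
    rw [integral_finsetSum _ fun a _ => hint (continuous_finsetSum _ fun b _ =>
      continuous_const.fun_mul (continuous_const.fun_mul ((continuous_tent b).fun_mul hp)))]
    refine Finset.sum_congr rfl fun a _ => ?_
    rw [integral_finsetSum _ fun b _ => hint
      (continuous_const.fun_mul (continuous_const.fun_mul ((continuous_tent b).fun_mul hp)))]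
    simp only [integral_const_mul]
  have h1 : ∫ y, greenSeries q (mapF q i x) y * p y ∂(mu q) =
      ∫ y, greenTerm q 0 (mapF q i x) y * p y ∂(mu q) +
        1 / 5 * ∫ y, greenSeries q x y * p (mapF q i y) ∂(mu q) := by
    rw [integral_self_similar ((continuous_greenSeries_right _).fun_mul hp),
      integral_self_similar (hc.fun_mul hp)]
    have h2 : ∀ j, ∫ y, greenSeries q (mapF q i x) (mapF q j y) * p (mapF q j y) ∂(mu q) =
        ∫ y, greenTerm q 0 (mapF q i x) (mapF q j y) * p (mapF q j y) ∂(mu q) +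
          if i = j then 3 / 5 * ∫ y, greenSeries q x y * p (mapF q i y) ∂(mu q) else 0 := by
      intro j
      have hp' : Continuous fun y => p (mapF q j y) := hp.comp (continuous_mapF j)
      have hc' : Continuous fun y => greenTerm q 0 (mapF q i x) (mapF q j y) :=
        hc.comp (continuous_mapF j)
      simp only [greenSeries_mapF, add_mul]
      rw [integral_add (hint (hc'.fun_mul hp'))]
      · congr 1
        split_ifs with hij
        · subst hij
          simp only [mul_assoc, integral_const_mul]
        · simp
      · split_ifs
        · exact hint ((continuous_const.fun_mul (continuous_greenSeries_right x)).fun_mul hp')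
        · simp
    simp only [h2, Finset.sum_add_distrib, Finset.sum_ite_eq, Finset.mem_univ, if_true]
    ring
  unfold potential
  rw [h1, h0]
  simp only [Function.comp]
  ring

/-- The self-similarity of the Green operator. -/
theorem potential_comp_mapF {p : gasket q → ℝ} (hp : Continuous p) (i : Fin 3) :
    potential q p ∘ mapF q i =
      harm q (fun k => potential q p (mapF q i (corner q k))) +
        (1 / 5 : ℝ) • potential q (p ∘ mapF q i) := by
  funext x
  have h : ∀ x, potential q p (mapF q i x) = _ := potential_mapF_eq_sum hp i
  simp only [Function.comp, Pi.add_apply, Pi.smul_apply, smul_eq_mul]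
  rw [h x, harm_eq_sum]
  congr 1
  simp only [h, potential_corner, tent_mapF, harmBasis_corner, mul_zero, add_zero]
  fin_cases i <;> simp [Fin.sum_univ_three] <;> ring

theorem potential_midpoint {p : gasket q → ℝ} (hp : Continuous p) (c : Fin 3) :
    potential q p (midpoint q c) =
      -∑ b, midCoeff c b * ∫ y, tent q b y * p y ∂(mu q) := by
  have h := potential_mapF_eq_sum hp (c + 1) (corner q (c + 2))
  change potential q p (midpoint q c) = _ at h
  rw [h, potential_corner, mul_zero, add_zero]
  change -∑ a, ∑ b, midCoeff a b * tent q a (midpoint q c) * _ = _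
  simp [tent_midpoint]

theorem potential_mapF_corner {p : gasket q → ℝ} (i k : Fin 3) :
    potential q p (mapF q i (corner q k)) =
      if k = i then 0 else potential q p (midpoint q (-(i + k))) := by
  split_ifs with h
  · rw [h, mapF_corner_self, potential_corner]
  · rw [mapF_corner_eq_midpoint (Ne.symm h)]

/-- The discrete Gauss–Green formula at a corner: up to the renormalization the graph Laplacian of
`T p` is the integral of `p` against the spline of level `m` that peaks there, minus that against the
one of level zero. -/
theorem graphLaplacian_potential_corner (m : ℕ) {p : gasket q → ℝ} (hp : Continuous p)
    (j : Fin 3) :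
    graphLaplacian q m (potential q p) (corner q j) =
      -((3 / 5) ^ m * (moment q p j - (1 / 3) ^ m * moment q (p ∘ (mapF q j)^[m]) j)) := by
  induction m generalizing p with
  | zero => simp [graphLaplacian_corner_zero, potential_corner]
  | succ m ih =>
    rw [graphLaplacian_corner_succ, potential_comp_mapF hp, graphLaplacian_add,
      graphLaplacian_smul, graphLaplacian_harm_corner, ih (hp.comp (continuous_mapF j)),
      Function.comp_assoc, ← Function.iterate_succ']
    have key : ∑ k, (potential q p (mapF q j (corner q k)) -
        potential q p (mapF q j (corner q j))) =
        1 / 5 * moment q (p ∘ mapF q j) j - 3 / 5 * moment q p j := by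
      simp only [potential_mapF_corner, potential_midpoint hp, integral_tent_mul hp,
        moment_self_similar hp j]
      fin_cases j <;> simp [Fin.sum_univ_three, midCoeff, harmStep, Pi.single_apply] <;> ring
    rw [key]
    ring

/-- Where two cells meet, the renormalized graph Laplacian of `T p` is the integral of `p` against the
spline that peaks there: the contributions of level zero cancel. -/
theorem graphLaplacian_potential_junction (m : ℕ) {p : gasket q → ℝ} (hp : Continuous p)
    {i j : Fin 3} (hij : i ≠ j) :
    graphLaplacian q (m + 1) (potential q p) (mapF q i (corner q j)) =
      (1 / 5) ^ (m + 1) * (moment q (p ∘ mapF q i ∘ (mapF q j)^[m]) j +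
        moment q (p ∘ mapF q j ∘ (mapF q i)^[m]) i) := by
  rw [graphLaplacian_junction m hij, potential_comp_mapF hp, potential_comp_mapF hp,
    graphLaplacian_add, graphLaplacian_add, graphLaplacian_smul, graphLaplacian_smul,
    graphLaplacian_harm_corner, graphLaplacian_harm_corner,
    graphLaplacian_potential_corner m (hp.comp (continuous_mapF i)),
    graphLaplacian_potential_corner m (hp.comp (continuous_mapF j)), Function.comp_assoc,
    Function.comp_assoc]
  have key : ∑ k, (potential q p (mapF q i (corner q k)) -
        potential q p (mapF q i (corner q j))) +
      ∑ k, (potential q p (mapF q j (corner q k)) - potential q p (mapF q j (corner q i))) =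
        1 / 5 * (moment q (p ∘ mapF q i) j + moment q (p ∘ mapF q j) i) := by
    simp only [potential_mapF_corner, potential_midpoint hp, integral_tent_mul hp]
    revert hij
    fin_cases i <;> fin_cases j <;> simp [Fin.sum_univ_three, midCoeff] <;> ring
  have h5 : (3 / 5 : ℝ) ^ m * (1 / 3) ^ m = (1 / 5) ^ m := by
    rw [← mul_pow]; norm_num
  rw [pow_succ, ← h5]
  linear_combination (3 / 5) ^ m * key

/-- The functions `harmBasis q j` are nonnegative with integral `1 / 3`. -/
theorem abs_moment_sub_le {g : gasket q → ℝ} (hg : Continuous g) {c ε : ℝ}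
    (h : ∀ x, |g x - c| ≤ ε) (j : Fin 3) : |moment q g j - 1 / 3 * c| ≤ 1 / 3 * ε := by
  have hi : ∀ {u : gasket q → ℝ}, Continuous u → Integrable u (mu q) := fun h =>
    integrable_of_continuous h _
  have hb := continuous_harmBasis (q := q) j
  have h1 : moment q g j - 1 / 3 * c = ∫ x, harmBasis q j x * (g x - c) ∂(mu q) := by
    simp only [mul_sub]
    rw [integral_sub (hi (hb.fun_mul hg)) (hi (hb.fun_mul continuous_const)), integral_mul_const,
      integral_harmBasis]
    rfl
  rw [h1]
  calc _ ≤ ∫ x, |harmBasis q j x * (g x - c)| ∂(mu q) := abs_integral_le_integral_abs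
    _ ≤ ∫ x, harmBasis q j x * ε ∂(mu q) := by
      refine integral_mono (hi (hb.fun_mul (hg.fun_sub continuous_const)).abs)
        (hi (hb.fun_mul continuous_const)) fun x => ?_
      simp only [abs_mul, abs_of_nonneg (harmBasis_nonneg j x)]
      exact mul_le_mul_of_nonneg_left (h x) (harmBasis_nonneg j x)
    _ = _ := by rw [integral_mul_const, integral_harmBasis]

/-- The discrete Laplacian of `T p` at a vertex is a weighted mean of `p` over the two cells of level
`m` that contain it. -/
theorem abs_graphLaplacian_potential_sub_le (m : ℕ) {p : gasket q → ℝ} (hp : Continuous p)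
    {ε : ℝ} (h : ∀ w : List (Fin 3), m ≤ w.length → ∀ x y, |p (mapW q w x) - p (mapW q w y)| ≤ ε)
    {x : gasket q} (hx : x ∈ vertices q m) (hx0 : x ∉ vertices q 0) :
    |3 / 2 * 5 ^ m * graphLaplacian q m (potential q p) x - p x| ≤ ε := by
  induction m generalizing p x with
  | zero => exact absurd hx hx0
  | succ m ih =>
    rcases interior_vertex_cases hx hx0 with ⟨i, y, hy, hy0, rfl⟩ | ⟨i, j, hij, rfl⟩
    · have h1 := ih (hp.comp (continuous_mapF i))
        (fun w hw a b => h (i :: w) (by simpa using hw) a b) hy hy0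
      rw [graphLaplacian_mapF i hy0, potential_comp_mapF hp, graphLaplacian_add,
        graphLaplacian_smul, graphLaplacian_harm m _ hy hy0, zero_add]
      convert h1 using 2
      simp only [Function.comp]
      ring
    · have hfix : ∀ a, (mapF q a)^[m] (corner q a) = corner q a := fun a =>
        Function.iterate_fixed (mapF_corner_self a) m
      have hm : ∀ a b, mapF q a (corner q b) = mapF q i (corner q j) →
          |moment q (p ∘ mapF q a ∘ (mapF q b)^[m]) b - 1 / 3 * p (mapF q i (corner q j))|
            ≤ 1 / 3 * ε := by
        intro a b hab
        refine abs_moment_sub_le (hp.comp ((continuous_mapF a).comp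
          ((continuous_mapF b).iterate m))) (fun x => ?_) b
        have := h (a :: List.replicate m b) (by simp) x (corner q b)
        simp only [mapW, Function.comp_apply, mapW_replicate, hfix, hab] at this
        exact this
      have h1 := hm i j rfl
      have h2 := hm j i (mapF_corner_comm j i)
      rw [graphLaplacian_potential_junction m hp hij]
      have h5 : (5 : ℝ) ^ (m + 1) * (1 / 5) ^ (m + 1) = 1 := by
        rw [← mul_pow]; norm_num
      rw [show ∀ s : ℝ, 3 / 2 * 5 ^ (m + 1) * ((1 / 5) ^ (m + 1) * s)
        = 3 / 2 * s * (5 ^ (m + 1) * (1 / 5) ^ (m + 1)) by intro s; ring, h5]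
      rw [abs_le] at *
      constructor <;> linarith

theorem hasLaplacian_potential {p : gasket q → ℝ} (hp : Continuous p) :
    HasLaplacian q (potential q p) p := by
  refine ⟨continuous_potential hp, hp, fun ε hε => ?_⟩
  obtain ⟨N, hN⟩ := exists_oscillation_lt hp (half_pos hε)
  exact ⟨N, fun m hm x hx hx0 => (abs_graphLaplacian_potential_sub_le m hp
    (fun w hw x y => (hN w (hm.trans hw) x y).le) hx hx0).trans_lt (half_lt_self hε)⟩

end GreenOperator

section Uniqueness

variable {q : Fin 3 → Plane}

/-! ### The maximum principle and uniqueness for the Dirichlet problem -/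

/-- The maximum principle for strictly subharmonic functions. -/
theorem nonpos_of_hasLaplacian_pos {u f : gasket q → ℝ} (h : HasLaplacian q u f) {δ : ℝ}
    (hδ : 0 < δ) (hf : ∀ x, δ ≤ f x) (h0 : ∀ i, u (corner q i) ≤ 0) (x : gasket q) : u x ≤ 0 := by
  obtain ⟨N, hN⟩ := h.2.2 δ hδ
  have hV : ∀ m, N ≤ m → ∀ y ∈ vertices q m, u y ≤ 0 := by
    intro m hm y hy
    obtain ⟨z, hz, hmax⟩ := (vertices q m).exists_max_image u ⟨_, corner_mem_vertices m 0⟩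
    refine (hmax y hy).trans ?_
    by_cases hz0 : z ∈ vertices q 0
    · obtain ⟨i, rfl⟩ := mem_vertices_zero.1 hz0
      exact h0 i
    · -- At an interior maximum the graph Laplacian is nonpositive, but here it is positive.
      have h1 : graphLaplacian q m u z ≤ 0 := Finset.sum_nonpos fun y hy =>
        sub_nonpos.2 (hmax y (mem_neighbors.1 hy).1)
      have h2 := hN m hm z hz hz0
      have h3 : 3 / 2 * 5 ^ m * graphLaplacian q m u z ≤ 0 :=
        mul_nonpos_of_nonneg_of_nonpos (by positivity) h1
      rw [abs_lt] at h2
      linarith [hf z]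
  have h1 := eq_zero_of_forall_mapW (u := fun x => max (u x) 0) (h.1.max continuous_const)
    (corner q 0) fun w => max_eq_right
      (hV _ (le_max_left N w.length) _ (vertices_mono (le_max_right N w.length)
        (mapW_corner_mem_vertices w 0)))
  exact max_eq_right_iff.1 (congrFun h1 x)

variable [hq : Fact (IsEquilateral q)]

/-- The maximum principle for harmonic functions, with the barrier `ε T 1`, whose Laplacian is the
constant `ε`. -/
theorem nonpos_of_hasLaplacian_zero {u : gasket q → ℝ} (h : HasLaplacian q u 0)
    (h0 : ∀ i, u (corner q i) = 0) (x : gasket q) : u x ≤ 0 := by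
  have hφ := hasLaplacian_potential (q := q) (p := 1) continuous_one
  refine le_of_forall_pos_le_add fun ε hε => ?_
  set η := ε / (|potential q 1 x| + 1)
  have hη : 0 < η := by positivity
  have h1 := nonpos_of_hasLaplacian_pos (h.add (hφ.smul η)) hη (fun y => by simp)
    (fun i => by simp [h0, potential_corner]) x
  simp only [Pi.add_apply, Pi.smul_apply, smul_eq_mul] at h1
  have h2 : η * (|potential q 1 x| + 1) = ε := div_mul_cancel₀ _ (by positivity)
  nlinarith [neg_abs_le (potential q 1 x)]

theorem dirichlet_unique {u v f : gasket q → ℝ} (hu : HasLaplacian q u f)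
    (hv : HasLaplacian q v f) (h : ∀ i, u (corner q i) = v (corner q i)) : u = v := by
  have h1 := hu.sub hv
  have h2 := hv.sub hu
  rw [sub_self] at h1 h2
  funext x
  have h3 := nonpos_of_hasLaplacian_zero h1 (fun i => by simp [h]) x
  have h4 := nonpos_of_hasLaplacian_zero h2 (fun i => by simp [h]) x
  simp only [Pi.sub_apply] at h3 h4
  linarith

theorem eq_harm {u : gasket q → ℝ} (hu : HasLaplacian q u 0) :
    u = harm q fun i => u (corner q i) :=
  dirichlet_unique hu (hasLaplacian_harm _) fun i => by simp

/-! ### Identification of the splines and of the Green function -/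

theorem isSpline_hat {m : ℕ} {z : gasket q} (hz : z ∈ vertices q m) :
    IsSpline q m z (hat q m z) := by
  refine ⟨?_, ?_, ?_, ?_⟩
  · rintro w rfl
    unfold hat
    rw [interp_comp_mapW]
    exact hasLaplacian_harm _
  · rw [hat_vertex z hz, if_pos rfl]
  · intro x hx hxz
    rw [hat_vertex z hx, if_neg hxz]
  · intro x hx
    obtain ⟨w, y, rfl, rfl⟩ := exists_mapW_eq m x
    have h := congrFun (interp_comp_mapW (q := q) w fun x => by
      classical exact if x = z then 1 else 0) y
    refine h.trans ((congrArg (fun a => harm q a y)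
      (funext fun j => if_neg ?_ : _ = (0 : Fin 3 → ℝ))).trans (harm_eq_zero y))
    rintro rfl
    exact hx ⟨w, rfl, ⟨_, rfl⟩, ⟨_, rfl⟩⟩

theorem IsSpline.eq_hat {m : ℕ} {z : gasket q} {ψ : gasket q → ℝ} (h : IsSpline q m z ψ)
    (hz : z ∈ vertices q m) : ψ = hat q m z := by
  have hv : ∀ x ∈ vertices q m, ψ x = hat q m z x := by
    intro x hx
    rw [hat_vertex z hx]
    split_ifs with hxz
    · rw [hxz, h.2.1]
    · exact h.2.2.1 x hx hxz
  funext x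
  obtain ⟨w, y, rfl, rfl⟩ := exists_mapW_eq m x
  have h2 := dirichlet_unique (h.1 w rfl) ((isSpline_hat hz).1 w rfl) fun i =>
    hv _ (mapW_corner_mem_vertices w i)
  exact congrFun h2 y

theorem spline_eq_hat {m : ℕ} {z : gasket q} (hz : z ∈ vertices q m) :
    spline q m z = hat q m z := by
  have h : ∃ ψ, IsSpline q m z ψ := ⟨_, isSpline_hat hz⟩
  rw [spline, dif_pos h]
  exact h.choose_spec.eq_hat hz

theorem greenPartial_eq_sum (M : ℕ) (x y : gasket q) :
    greenPartial q M x y = ∑ m ∈ Finset.range (M + 1), greenTerm q m x y := by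
  unfold greenPartial greenTerm
  refine Finset.sum_congr rfl fun m _ => Finset.sum_congr rfl fun z hz =>
    Finset.sum_congr rfl fun z' hz' => ?_
  rw [spline_eq_hat (Finset.mem_sdiff.1 hz).1, spline_eq_hat (Finset.mem_sdiff.1 hz').1]

theorem tendsto_greenPartial_greenSeries (x y : gasket q) :
    Tendsto (fun M => greenPartial q M x y) atTop (𝓝 (greenSeries q x y)) := by
  simp only [greenPartial_eq_sum]
  exact (tendsto_add_atTop_iff_nat 1).2 (summable_greenTerm x y).hasSum.tendsto_sum_nat

theorem green_eq_greenSeries (x y : gasket q) : green q x y = greenSeries q x y :=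
  (tendsto_greenPartial_greenSeries x y).limUnder_eq

theorem auxPoly_succ (p : ℕ → gasket q → ℝ) (k : ℕ) :
    auxPoly q p (k + 1) = potential q (p k) := by
  funext x
  simp only [auxPoly, potential, green_eq_greenSeries]

/-- The Green operator is self-adjoint. -/
theorem ip_potential_comm {u v : gasket q → ℝ} (hu : Continuous u) (hv : Continuous v) :
    ip q (potential q u) v = ip q u (potential q v) := by
  unfold ip potential
  have hc : Continuous (Function.uncurry fun x y => greenSeries q x y * u y * v x) :=
    (continuous_greenSeries.fun_mul (hu.comp continuous_snd)).fun_mul (hv.comp continuous_fst)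
  have h1 : ∀ x, (-∫ y, greenSeries q x y * u y ∂(mu q)) * v x =
      -∫ y, greenSeries q x y * u y * v x ∂(mu q) := by
    intro x
    rw [integral_mul_const]; ring
  have h2 : ∀ y, u y * (-∫ x, greenSeries q y x * v x ∂(mu q)) =
      -∫ x, greenSeries q x y * u y * v x ∂(mu q) := by
    intro y
    rw [mul_neg, ← integral_const_mul]
    congr 1
    refine integral_congr_ae (Eventually.of_forall fun x => ?_)
    simp only [greenSeries_symm y x]
    ring
  simp only [h1, h2, integral_neg]
  rw [integral_integral_swap (integrable_of_continuous hc _)]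

end Uniqueness

section LinearAlgebra

variable {q : Fin 3 → Plane}

/-! ### Gram–Schmidt and the three-term recursion in linear algebra -/

section ThreeTerm

variable {V : Type*} [AddCommGroup V] [Module ℝ V] {B : V →ₗ[ℝ] V →ₗ[ℝ] ℝ} {P p : ℕ → V}

/-- The span of the first `k` vectors of a sequence. -/
def spanBelow (P : ℕ → V) (k : ℕ) : Submodule ℝ V := Submodule.span ℝ (P '' Set.Iio k)

theorem mem_spanBelow {k l : ℕ} (h : l < k) : P l ∈ spanBelow P k :=
  Submodule.subset_span ⟨l, h, rfl⟩

theorem spanBelow_mono : Monotone (spanBelow P) := fun _ _ h =>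
  Submodule.span_mono (Set.image_mono (Set.Iio_subset_Iio h))

/-- `p` is obtained from `P` by the Gram–Schmidt process, without normalization, for the bilinear
form `B`. -/
def IsGramSchmidt (B : V →ₗ[ℝ] V →ₗ[ℝ] ℝ) (P p : ℕ → V) : Prop :=
  ∀ k, p k = P k - ∑ l : Fin k, ((B (p l) (p l))⁻¹ * B (P k) (p l)) • p l

namespace IsGramSchmidt

theorem self_sub_mem (h : IsGramSchmidt B P p) (k : ℕ) : p k - P k ∈ spanBelow P k := by
  induction k using Nat.strong_induction_on with
  | _ k ih =>
    rw [h k, sub_sub_cancel_left]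
    refine neg_mem (sum_mem fun l _ => Submodule.smul_mem _ _ ?_)
    have h1 := spanBelow_mono l.2.le (ih l l.2)
    simpa using add_mem h1 (mem_spanBelow (P := P) l.2)

theorem self_mem (h : IsGramSchmidt B P p) {k l : ℕ} (hl : l < k) : p l ∈ spanBelow P k := by
  have h1 := spanBelow_mono hl.le (h.self_sub_mem l)
  simpa using add_mem h1 (mem_spanBelow (P := P) hl)

theorem ne_zero (h : IsGramSchmidt B P p) (hP : ∀ k, P k ∉ spanBelow P k) (k : ℕ) : p k ≠ 0 := by
  intro h0
  have := h.self_sub_mem k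
  rw [h0, zero_sub, neg_mem_iff] at this
  exact hP k this

/-- A vector orthogonal to the first `k` orthogonalized vectors is orthogonal to the span of the
first `k` original ones. -/
theorem eq_zero_of_mem_spanBelow (h : IsGramSchmidt B P p) {g : V} {k : ℕ}
    (hg : ∀ l < k, B g (p l) = 0) {v : V} (hv : v ∈ spanBelow P k) : B g v = 0 := by
  have key : ∀ l < k, B g (P l) = 0 := by
    intro l
    induction l using Nat.strong_induction_on with
    | _ l ih =>
      intro hl
      have h1 : spanBelow P l ≤ LinearMap.ker (B g) := by
        refine Submodule.span_le.2 ?_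
        rintro _ ⟨l', hl', rfl⟩
        exact ih l' hl' (lt_trans hl' hl)
      have h2 : B g (p l - P l) = 0 := h1 (h.self_sub_mem l)
      rw [map_sub, hg l hl, zero_sub, neg_eq_zero] at h2
      exact h2
  have h1 : spanBelow P k ≤ LinearMap.ker (B g) := by
    refine Submodule.span_le.2 ?_
    rintro _ ⟨l, hl, rfl⟩
    exact key l hl
  exact h1 hv

variable (hsymm : ∀ u v, B u v = B v u) (hpos : ∀ v, v ≠ 0 → 0 < B v v)
include hsymm hpos

theorem orthogonal (h : IsGramSchmidt B P p) (hP : ∀ k, P k ∉ spanBelow P k) {k l : ℕ}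
    (hl : l < k) : B (p k) (p l) = 0 := by
  induction k using Nat.strong_induction_on generalizing l with
  | _ k ih =>
    have hne : B (p l) (p l) ≠ 0 := (hpos _ (h.ne_zero hP l)).ne'
    have horth : ∀ j : Fin k, j ≠ ⟨l, hl⟩ → B (p j) (p l) = 0 := by
      intro j hj
      rcases lt_or_gt_of_ne (fun e : (j : ℕ) = l => hj (Fin.ext e)) with hlt | hgt
      · rw [hsymm]; exact ih l hl hlt
      · exact ih j j.2 hgt
    rw [h k, map_sub, LinearMap.sub_apply, map_sum, LinearMap.sum_apply,
      Finset.sum_eq_single ⟨l, hl⟩]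
    · simp only [map_smul, LinearMap.smul_apply, smul_eq_mul]
      field_simp
      ring
    · intro j _ hj
      simp [horth j hj]
    · simp

/-- The orthogonalized vector `p k` is characterized by its leading term and orthogonality. -/
theorem eq_of_orthogonal (h : IsGramSchmidt B P p) (hP : ∀ k, P k ∉ spanBelow P k) {k : ℕ} {g : V}
    (hg : g - P k ∈ spanBelow P k) (ho : ∀ l < k, B g (p l) = 0) : p k = g := by
  by_contra hne
  have h1 : p k - g ∈ spanBelow P k := by
    simpa using sub_mem (h.self_sub_mem k) hg
  have h2 := h.eq_zero_of_mem_spanBelow (g := p k - g) (k := k) (fun l hl => by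
    rw [map_sub, LinearMap.sub_apply, h.orthogonal hsymm hpos hP hl, ho l hl, sub_zero]) h1
  exact (hpos _ (sub_ne_zero.2 hne)).ne' h2

variable {T : V →ₗ[ℝ] V} (hT : ∀ u v, B (T u) v = B u (T v))
  (hTP : ∀ l, T (P l) - P (l + 1) ∈ spanBelow P 1)

omit hsymm hpos in
include hTP in
theorem map_self_sub_mem (h : IsGramSchmidt B P p) (k : ℕ) :
    T (p k) - P (k + 1) ∈ spanBelow P (k + 1) := by
  have h1 : spanBelow P k ≤ (spanBelow P (k + 1)).comap T := by
    refine Submodule.span_le.2 ?_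
    rintro _ ⟨l, hl, rfl⟩
    have h2 := spanBelow_mono (Nat.le_add_left 1 k) (hTP l)
    simpa using add_mem h2 (mem_spanBelow (P := P) (Nat.succ_lt_succ hl))
  have h2 : T (p k - P k) ∈ spanBelow P (k + 1) := h1 (h.self_sub_mem k)
  have h3 := add_mem h2 (spanBelow_mono (Nat.le_add_left 1 k) (hTP k))
  simpa using h3

include hTP

theorem three_term_zero (h : IsGramSchmidt B P p) (hP : ∀ k, P k ∉ spanBelow P k) :
    p 1 = T (p 0) - (B (T (p 0)) (p 0) / B (p 0) (p 0)) • p 0 := by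
  refine h.eq_of_orthogonal hsymm hpos hP ?_ ?_
  · rw [sub_right_comm]
    exact sub_mem (h.map_self_sub_mem hTP 0) (Submodule.smul_mem _ _ (h.self_mem one_pos))
  · intro l hl
    obtain rfl : l = 0 := by omega
    have hne : B (p 0) (p 0) ≠ 0 := (hpos _ (h.ne_zero hP 0)).ne'
    simp [hne]

include hT in
/-- The three-term recursion. The vector `T (p (k + 1))` is orthogonal to `p l` for `l < k`, because
`T` is symmetric and `T (p l)` lies in the span of `p 0, …, p (l + 1)`. -/
theorem three_term_succ (h : IsGramSchmidt B P p) (hP : ∀ k, P k ∉ spanBelow P k) (k : ℕ) :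
    p (k + 2) = T (p (k + 1)) - (B (T (p (k + 1))) (p (k + 1)) / B (p (k + 1)) (p (k + 1))) •
      p (k + 1) - (B (p (k + 1)) (p (k + 1)) / B (p k) (p k)) • p k := by
  have hne : ∀ l, B (p l) (p l) ≠ 0 := fun l => (hpos _ (h.ne_zero hP l)).ne'
  refine h.eq_of_orthogonal hsymm hpos hP ?_ ?_
  · rw [sub_right_comm, sub_right_comm (T _)]
    exact sub_mem (sub_mem (h.map_self_sub_mem hTP (k + 1))
      (Submodule.smul_mem _ _ (h.self_mem (by omega)))) (Submodule.smul_mem _ _ (h.self_mem (by omega)))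
  · intro l hl
    -- `T (p l)` and `p (l + 1)` have the same leading term.
    have h1 : l < k + 1 → B (p (k + 1)) (T (p l)) = B (p (k + 1)) (p (l + 1)) := by
      intro hlk
      have h2 : T (p l) - p (l + 1) ∈ spanBelow P (k + 1) := by
        have := sub_mem (h.map_self_sub_mem hTP l) (h.self_sub_mem (l + 1))
        rw [sub_sub_sub_cancel_right] at this
        exact spanBelow_mono (by omega) this
      have h3 := h.eq_zero_of_mem_spanBelow (g := p (k + 1)) (k := k + 1)
        (fun l hl => h.orthogonal hsymm hpos hP hl) h2
      rwa [map_sub, sub_eq_zero] at h3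
    simp only [map_sub, LinearMap.sub_apply, map_smul, LinearMap.smul_apply, smul_eq_mul]
    rcases lt_trichotomy l k with hlk | rfl | hlk
    · rw [hT, h1 (by omega), h.orthogonal hsymm hpos hP (show l < k + 1 by omega),
        h.orthogonal hsymm hpos hP hlk, h.orthogonal hsymm hpos hP (show l + 1 < k + 1 by omega)]
      simp
    · rw [hT, h1 (by omega), h.orthogonal hsymm hpos hP (Nat.lt_succ_self l),
        div_mul_cancel₀ _ (hne l)]
      simp
    · obtain rfl : l = k + 1 := by omega
      rw [hsymm (p k) (p (k + 1)), h.orthogonal hsymm hpos hP (Nat.lt_succ_self k), div_mul_cancel₀ _ (hne _)]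
      simp

end IsGramSchmidt

end ThreeTerm

end LinearAlgebra

section Monomials

variable {q : Fin 3 → Plane}

/-! ### Polynomials and monomials -/

theorem hasLaplacian_zero : HasLaplacian q 0 0 :=
  ⟨continuous_zero, continuous_zero, fun ε hε => ⟨0, fun m _ x _ _ => by
    simpa [graphLaplacian] using hε⟩⟩

theorem HasLaplacianIter.add {m : ℕ} {u v f g : gasket q → ℝ} (hu : HasLaplacianIter q m u f)
    (hv : HasLaplacianIter q m v g) : HasLaplacianIter q m (u + v) (f + g) := by
  induction m generalizing u v with
  | zero => exact congrArg₂ (· + ·) hu hv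
  | succ m ih =>
    obtain ⟨u', hu, hu'⟩ := hu
    obtain ⟨v', hv, hv'⟩ := hv
    exact ⟨_, hu.add hv, ih hu' hv'⟩

theorem HasLaplacianIter.smul {m : ℕ} {u f : gasket q → ℝ} (a : ℝ)
    (hu : HasLaplacianIter q m u f) : HasLaplacianIter q m (a • u) (a • f) := by
  induction m generalizing u with
  | zero => exact congrArg (a • ·) hu
  | succ m ih =>
    obtain ⟨u', hu, hu'⟩ := hu
    exact ⟨_, hu.smul a, ih hu'⟩

theorem HasLaplacianIter.succ {m : ℕ} {u f g : gasket q → ℝ} (hu : HasLaplacianIter q m u f)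
    (hf : HasLaplacian q f g) : HasLaplacianIter q (m + 1) u g := by
  induction m generalizing u with
  | zero =>
    obtain rfl : u = f := hu
    exact ⟨g, hf, rfl⟩
  | succ m ih =>
    obtain ⟨u', hu, hu'⟩ := hu
    exact ⟨u', hu, ih hu'⟩

theorem HasLaplacianIter.zero_mono {m k : ℕ} (hmk : m ≤ k) {u : gasket q → ℝ}
    (hu : HasLaplacianIter q m u 0) : HasLaplacianIter q k u 0 := by
  induction hmk with
  | refl => exact hu
  | step _ ih => exact ih.succ hasLaplacian_zero

theorem HasNormalDeriv.add {u v : gasket q → ℝ} {i : Fin 3} {a b : ℝ}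
    (hu : HasNormalDeriv q u i a) (hv : HasNormalDeriv q v i b) :
    HasNormalDeriv q (u + v) i (a + b) :=
  (Tendsto.add hu hv).congr fun m => by simp only [Pi.add_apply]; ring

theorem HasNormalDeriv.smul {u : gasket q → ℝ} {i : Fin 3} {a : ℝ} (c : ℝ)
    (hu : HasNormalDeriv q u i a) : HasNormalDeriv q (c • u) i (c * a) :=
  (Tendsto.const_mul c hu).congr fun m => by simp only [Pi.smul_apply, smul_eq_mul]; ring

theorem HasTangentialDeriv.add {u v : gasket q → ℝ} {i : Fin 3} {a b : ℝ}
    (hu : HasTangentialDeriv q u i a) (hv : HasTangentialDeriv q v i b) :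
    HasTangentialDeriv q (u + v) i (a + b) :=
  (Tendsto.add hu hv).congr fun m => by simp only [Pi.add_apply]; ring

theorem HasTangentialDeriv.smul {u : gasket q → ℝ} {i : Fin 3} {a : ℝ} (c : ℝ)
    (hu : HasTangentialDeriv q u i a) : HasTangentialDeriv q (c • u) i (c * a) :=
  (Tendsto.const_mul c hu).congr fun m => by simp only [Pi.smul_apply, smul_eq_mul]; ring

theorem IsMonomial.hasLaplacian_zero {n : Fin 3} {i : ℕ} {P : gasket q → ℝ}
    (hP : IsMonomial q n 0 i P) : HasLaplacian q P 0 := by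
  obtain ⟨R, hR, rfl⟩ := hP.1
  exact hR

theorem IsMonomial.corner_eq_zero {n : Fin 3} {j i : ℕ} {P : gasket q → ℝ} (hi : i = 2 ∨ i = 3)
    (hP : IsMonomial q n j i P) : P (corner q n) = 0 := by
  obtain ⟨v, rfl, h0, -⟩ := hP.2 0 (Nat.zero_le j)
  rw [h0, if_neg]
  omega

theorem eq_or_eq_add_or_eq_sub (n j : Fin 3) : j = n ∨ j = n + 1 ∨ j = n - 1 := by
  revert n j; decide

variable [hq : Fact (IsEquilateral q)]

theorem HasLaplacianIter.comp_perm {m : ℕ} {u f : gasket q → ℝ} (hu : HasLaplacianIter q m u f)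
    (σ : Equiv.Perm (Fin 3)) : HasLaplacianIter q m (u ∘ perm q σ) (f ∘ perm q σ) := by
  induction m generalizing u with
  | zero => exact congrArg (· ∘ perm q σ) hu
  | succ m ih =>
    obtain ⟨u', hu, hu'⟩ := hu
    exact ⟨_, hu.comp_perm σ, ih hu'⟩

theorem HasLaplacianIter.unique {m : ℕ} {u f g : gasket q → ℝ} (hf : HasLaplacianIter q m u f)
    (hg : HasLaplacianIter q m u g) : f = g := by
  induction m generalizing u with
  | zero => exact hf.symm.trans hg
  | succ m ih =>
    obtain ⟨v, hv, hv'⟩ := hf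
    obtain ⟨w, hw, hw'⟩ := hg
    obtain rfl := hv.unique hw
    exact ih hv' hw'

/-- A harmonic function is determined by its value and its normal and tangential derivatives at one
corner. -/
theorem eq_zero_of_harmonic_data {u : gasket q → ℝ} (hu : HasLaplacian q u 0) {n : Fin 3}
    (h0 : u (corner q n) = 0) (h1 : HasNormalDeriv q u n 0) (h2 : HasTangentialDeriv q u n 0) :
    u = 0 := by
  rw [eq_harm hu] at h1 h2 ⊢
  have e1 := tendsto_nhds_unique h1 (hasNormalDeriv_harm _ n)
  have e2 := tendsto_nhds_unique h2 (hasTangentialDeriv_harm _ n)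
  funext x
  rw [harm_eq_sum]
  refine Finset.sum_eq_zero fun j _ => ?_
  have : u (corner q j) = 0 := by
    have hj := eq_or_eq_add_or_eq_sub n j
    rcases hj with rfl | rfl | rfl <;> linarith
  rw [this, zero_mul]

/-- A polynomial is determined by its data at one corner. -/
theorem eq_zero_of_data {n : Fin 3} {j : ℕ} {u : gasket q → ℝ} (hu : IsPolynomial q j u)
    (h : ∀ m ≤ j, ∃ v, HasLaplacianIter q m u v ∧ v (corner q n) = 0 ∧
      HasNormalDeriv q v n 0 ∧ HasTangentialDeriv q v n 0) : u = 0 := by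
  induction j generalizing u with
  | zero =>
    obtain ⟨u', hu, rfl⟩ := hu
    obtain ⟨v, rfl, h0, h1, h2⟩ := h 0 le_rfl
    exact eq_zero_of_harmonic_data hu h0 h1 h2
  | succ j ih =>
    obtain ⟨u', hu, hu'⟩ := hu
    have h0 : u' = 0 := ih hu' fun m hm => by
      obtain ⟨v, ⟨u'', hu2, hv⟩, h⟩ := h (m + 1) (by omega)
      obtain rfl := hu.unique hu2
      exact ⟨v, hv, h⟩
    subst h0
    obtain ⟨v, rfl, h0, h1, h2⟩ := h 0 (Nat.zero_le _)
    exact eq_zero_of_harmonic_data hu h0 h1 h2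

theorem IsMonomial.unique {n : Fin 3} {j i : ℕ} {P Q : gasket q → ℝ} (hP : IsMonomial q n j i P)
    (hQ : IsMonomial q n j i Q) : P = Q := by
  have h1 : IsPolynomial q j (P + (-1 : ℝ) • Q) := by
    have := HasLaplacianIter.add hP.1 (HasLaplacianIter.smul (-1) hQ.1)
    rwa [smul_zero, add_zero] at this
  have h2 := eq_zero_of_data (n := n) h1 fun m hm => by
    obtain ⟨v, hv, h0, h1, h2⟩ := hP.2 m hm
    obtain ⟨w, hw, h0', h1', h2'⟩ := hQ.2 m hm
    refine ⟨_, hv.add (hw.smul (-1)), ?_, ?_, ?_⟩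
    · simp [h0, h0']
    · simpa only [neg_one_mul, add_neg_cancel] using h1.add (h1'.smul (-1))
    · simpa only [neg_one_mul, add_neg_cancel] using h2.add (h2'.smul (-1))
  funext x
  have := congrFun h2 x
  simp only [Pi.add_apply, Pi.smul_apply, smul_eq_mul, Pi.zero_apply] at this
  linarith

/-- `Δ P_{j+1}` has the data of `P_j`. -/
theorem IsMonomial.hasLaplacian {n : Fin 3} {j i : ℕ} {P Q : gasket q → ℝ}
    (hP : IsMonomial q n (j + 1) i P) (hQ : IsMonomial q n j i Q) : HasLaplacian q P Q := by
  obtain ⟨R, hR, hR'⟩ := hP.1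
  have : IsMonomial q n j i R := by
    refine ⟨hR', fun m hm => ?_⟩
    obtain ⟨v, ⟨S, hS, hv⟩, h⟩ := hP.2 (m + 1) (by omega)
    obtain rfl := hR.unique hS
    refine ⟨v, hv, ?_⟩
    simpa only [add_left_inj] using h
  rwa [← this.unique hQ]

theorem IsMonomial.ne_zero {n : Fin 3} {j i : ℕ} {P : gasket q → ℝ} (hi : i = 2 ∨ i = 3)
    (hP : IsMonomial q n j i P) : P ≠ 0 := by
  rintro rfl
  obtain ⟨v, hv, -, h1, h2⟩ := hP.2 j le_rfl
  obtain rfl := hv.unique (HasLaplacianIter.zero_mono (Nat.zero_le j)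
    (show HasLaplacianIter q 0 (0 : gasket q → ℝ) 0 from rfl))
  have e1 : HasNormalDeriv q (0 : gasket q → ℝ) n 0 := by simp [HasNormalDeriv]
  have e2 : HasTangentialDeriv q (0 : gasket q → ℝ) n 0 := by simp [HasTangentialDeriv]
  rcases hi with rfl | rfl
  · simpa using tendsto_nhds_unique e1 h1
  · simpa using tendsto_nhds_unique e2 h2

/-- The transposition of the two corners other than `q n`. -/
def reflection (n : Fin 3) : Equiv.Perm (Fin 3) := Equiv.swap (n + 1) (n - 1)

theorem reflection_self (n : Fin 3) : reflection n n = n := by revert n; decide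

theorem reflection_add (n : Fin 3) : reflection n (n + 1) = n - 1 := by revert n; decide

theorem reflection_sub (n : Fin 3) : reflection n (n - 1) = n + 1 := by revert n; decide

theorem perm_reflection_iterate (n : Fin 3) (m : ℕ) (x : gasket q) :
    perm q (reflection n) ((mapF q n)^[m] x) = (mapF q n)^[m] (perm q (reflection n) x) := by
  induction m with
  | zero => rfl
  | succ m ih =>
    rw [Function.iterate_succ_apply', Function.iterate_succ_apply', perm_mapF, ih,
      reflection_self]

theorem HasNormalDeriv.comp_reflection {u : gasket q → ℝ} {n : Fin 3} {a : ℝ}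
    (h : HasNormalDeriv q u n a) : HasNormalDeriv q (u ∘ perm q (reflection n)) n a :=
  Tendsto.congr (fun m => by
    simp only [Function.comp, perm_reflection_iterate, perm_corner, reflection_self,
      reflection_add, reflection_sub]
    ring) h

theorem HasTangentialDeriv.comp_reflection {u : gasket q → ℝ} {n : Fin 3} {a : ℝ}
    (h : HasTangentialDeriv q u n a) : HasTangentialDeriv q (u ∘ perm q (reflection n)) n (-a) :=
  Tendsto.congr (fun m => by
    simp only [Function.comp, perm_reflection_iterate, perm_corner,
      reflection_add, reflection_sub]
    ring) h.neg

/-- The sign of the monomials under the reflection that fixes `q n`: those with `i = 2` are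
symmetric, those with `i = 3` are antisymmetric. -/
noncomputable def reflectionSign (i : ℕ) : ℝ := if i = 3 then -1 else 1

/-- The reflection fixes `q_n`, keeps normal derivatives and changes the sign of tangential ones. -/
theorem IsMonomial.comp_reflection {n : Fin 3} {j i : ℕ} {P : gasket q → ℝ} (hi : i = 2 ∨ i = 3)
    (hP : IsMonomial q n j i P) : P ∘ perm q (reflection n) = reflectionSign i • P := by
  have hs : reflectionSign i * reflectionSign i = 1 := by
    unfold reflectionSign; split_ifs <;> norm_num
  have h : IsMonomial q n j i (reflectionSign i • (P ∘ perm q (reflection n))) := by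
    refine ⟨?_, fun m hm => ?_⟩
    · have := HasLaplacianIter.smul (reflectionSign i)
        (HasLaplacianIter.comp_perm hP.1 (reflection n))
      rwa [Pi.zero_comp, smul_zero] at this
    · obtain ⟨v, hv, h0, h1, h2⟩ := hP.2 m hm
      refine ⟨_, (hv.comp_perm (reflection n)).smul (reflectionSign i), ?_, ?_, ?_⟩
      · simp only [Pi.smul_apply, Function.comp, perm_corner, reflection_self, h0, smul_eq_mul]
        rcases hi with rfl | rfl <;> simp
      · convert h1.comp_reflection.smul (reflectionSign i) using 1
        rcases hi with rfl | rfl <;> simp [reflectionSign]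
      · convert h2.comp_reflection.smul (reflectionSign i) using 1
        rcases hi with rfl | rfl <;> by_cases hmj : m = j <;> simp [reflectionSign, hmj]
  conv_rhs => rw [hP.unique h]
  rw [smul_smul, hs, one_smul]

/-- The Green operator maps a monomial to the next one, up to a multiple of the harmonic monomial:
the difference is harmonic, vanishes at `q n` and has the symmetry of the monomials. -/
theorem potential_sub_monomial {n : Fin 3} {j i : ℕ} (hi : i = 2 ∨ i = 3)
    {P Q R : gasket q → ℝ} (hP : IsMonomial q n j i P) (hQ : IsMonomial q n (j + 1) i Q)
    (hR : IsMonomial q n 0 i R) : ∃ c : ℝ, potential q P - Q = c • R := by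
  set s := reflectionSign i
  have hPQ := hQ.hasLaplacian hP
  have hpot := hasLaplacian_potential hPQ.2.1
  have hh : HasLaplacian q (potential q P - Q) 0 := by simpa using hpot.sub hPQ
  have hsym : potential q P ∘ perm q (reflection n) = s • potential q P := by
    refine dirichlet_unique (f := s • P) ?_ (hpot.smul s) fun k => ?_
    · rw [← hP.comp_reflection hi]
      exact hpot.comp_perm _
    · simp [perm_corner, potential_corner]
  -- A harmonic function with the symmetry is determined by its value at one other corner.
  have key : ∀ u : gasket q → ℝ, HasLaplacian q u 0 → u ∘ perm q (reflection n) = s • u →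
      u (corner q n) = 0 → u (corner q (n + 1)) = 0 → u = 0 := by
    intro u hu hs h0 h1
    have h2 : u (corner q (n - 1)) = 0 := by
      have := congrFun hs (corner q (n + 1))
      simpa [perm_corner, reflection_add, h1] using this
    rw [eq_harm hu]
    funext x
    rw [harm_eq_sum]
    refine Finset.sum_eq_zero fun k _ => ?_
    have hk := eq_or_eq_add_or_eq_sub n k
    rcases hk with rfl | rfl | rfl
    · rw [h0, zero_mul]
    · rw [h1, zero_mul]
    · rw [h2, zero_mul]
  have hR1 : R (corner q (n + 1)) ≠ 0 := fun h =>
    hR.ne_zero hi (key R hR.hasLaplacian_zero (hR.comp_reflection hi) (hR.corner_eq_zero hi) h)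
  set c := (potential q P - Q) (corner q (n + 1)) / R (corner q (n + 1)) with hc
  refine ⟨c, sub_eq_zero.1 (key _ ?_ ?_ ?_ ?_)⟩
  · simpa using hh.sub (hR.hasLaplacian_zero.smul c)
  · have hQs := hQ.comp_reflection hi
    have hRs := hR.comp_reflection hi
    funext x
    have e1 := congrFun hsym x
    have e2 := congrFun hQs x
    have e3 := congrFun hRs x
    simp only [Function.comp, Pi.smul_apply, smul_eq_mul, Pi.sub_apply] at e1 e2 e3 ⊢
    rw [e1, e2, e3]
    ring
  · simp [potential_corner, hQ.corner_eq_zero hi, hR.corner_eq_zero hi]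
  · rw [Pi.sub_apply, Pi.smul_apply, smul_eq_mul, hc, div_mul_cancel₀ _ hR1, sub_self]

/-- The Green operator on the continuous functions. -/
noncomputable def greenOperator (q : Fin 3 → Plane) [Fact (IsEquilateral q)] :
    C(gasket q, ℝ) →ₗ[ℝ] C(gasket q, ℝ) where
  toFun p := ⟨potential q p, continuous_potential p.continuous⟩
  map_add' u v := ContinuousMap.coe_injective <|
    dirichlet_unique (hasLaplacian_potential (u + v).continuous)
      ((hasLaplacian_potential u.continuous).add (hasLaplacian_potential v.continuous))
      fun i => by simp [potential_corner]
  map_smul' c u := ContinuousMap.coe_injective <|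
    dirichlet_unique (hasLaplacian_potential (c • u).continuous)
      ((hasLaplacian_potential u.continuous).smul c) fun i => by simp [potential_corner]

theorem coe_greenOperator (p : C(gasket q, ℝ)) : ⇑(greenOperator q p) = potential q p := rfl

end Monomials

section Recursion

variable {q : Fin 3 → Plane}

/-! ### The three-term recursion for the orthogonal polynomials -/

theorem continuous_orthoPoly {P : ℕ → gasket q → ℝ} (hP : ∀ k, Continuous (P k)) (k : ℕ) :
    Continuous (orthoPoly q P k) := by
  induction k using Nat.strong_induction_on with
  | _ k ih =>
    rw [orthoPoly]
    refine (hP k).sub ?_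
    have h : ∀ l : Fin k, Continuous (((normL2 q (orthoPoly q P l))⁻¹ ^ 2 *
        ip q (P k) (orthoPoly q P l)) • orthoPoly q P l) := fun l => (ih l l.2).const_smul _
    have h2 := continuous_finsetSum Finset.univ fun l _ => h l
    convert h2 using 1
    funext x
    simp

theorem isGramSchmidt_orthoPoly {P : ℕ → gasket q → ℝ} (hP : ∀ k, Continuous (P k)) :
    IsGramSchmidt (ipForm q) (fun k => (⟨P k, hP k⟩ : C(gasket q, ℝ)))
      fun k => ⟨orthoPoly q P k, continuous_orthoPoly hP k⟩ := by
  intro k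
  ext x
  have h := congrFun (orthoPoly.eq_1 q P k) x
  rw [ContinuousMap.coe_mk, h]
  simp [ipForm_apply, ← normL2_sq]

theorem hasLaplacianIter_of_mem_spanBelow {n : Fin 3} {i : ℕ} {P : ℕ → C(gasket q, ℝ)}
    (hP : ∀ j, IsMonomial q n j i (P j)) {k : ℕ} {u : C(gasket q, ℝ)} (hu : u ∈ spanBelow P k) :
    HasLaplacianIter q k u 0 := by
  induction hu using Submodule.span_induction with
  | mem u hu =>
    obtain ⟨l, hl, rfl⟩ := hu
    exact HasLaplacianIter.zero_mono (Nat.succ_le_of_lt hl) (hP l).1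
  | zero => exact HasLaplacianIter.zero_mono (Nat.zero_le k) rfl
  | add u v _ _ hu hv => simpa using hu.add hv
  | smul c u _ hu => simpa using hu.smul c

variable [hq : Fact (IsEquilateral q)]

/-- The monomials of lower degree lie in the kernel of `Δ^k`, while `Δ^k P_k = P_0`. -/
theorem IsMonomial.notMem_spanBelow {n : Fin 3} {i : ℕ} (hi : i = 2 ∨ i = 3)
    {P : ℕ → C(gasket q, ℝ)} (hP : ∀ j, IsMonomial q n j i (P j)) (k : ℕ) :
    P k ∉ spanBelow P k := by
  have h0 : ∀ k, HasLaplacianIter q k (P k) (P 0) := by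
    intro k
    induction k with
    | zero => rfl
    | succ k ih => exact ⟨P k, (hP (k + 1)).hasLaplacian (hP k), ih⟩
  intro h
  exact (hP 0).ne_zero hi ((h0 k).unique (hasLaplacianIter_of_mem_spanBelow hP h))

theorem integrable_green_mul {p : gasket q → ℝ} (hp : Continuous p) (x : gasket q) :
    Integrable (fun y => green q x y * p y) (mu q) := by
  simp only [green_eq_greenSeries]
  exact integrable_of_continuous ((continuous_greenSeries_right x).fun_mul hp) _

end Recursion

end SGasket

open SGasket in
theorem theorem3p3 (q : Fin 3 → SGasket.Plane) (hq : SGasket.IsEquilateral q)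
    (n : Fin 3) (i : ℕ) (hi : i = 2 ∨ i = 3)
    (P : ℕ → SGasket.gasket q → ℝ) (hP : ∀ j, SGasket.IsMonomial q n j i (P j))
    (p : ℕ → SGasket.gasket q → ℝ) (hp : p = SGasket.orthoPoly q P)
    (f : ℕ → SGasket.gasket q → ℝ) (hf : f = SGasket.auxPoly q p)
    (d : ℕ → ℝ) (hd : ∀ k, d k = (SGasket.normL2 q (p k))⁻¹)
    (b : ℕ → ℝ) (hb : ∀ k, b k = d k ^ 2 * SGasket.ip q (f (k + 1)) (p k))
    (c : ℕ → ℝ) (hc : ∀ k, c (k + 1) = d k ^ 2 / d (k + 1) ^ 2) :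
    -- the objects in the recursion are well defined: the limit that defines `G` exists, `p_k ≠ 0`
    -- in `L²`, the integral that defines `f_{k+1}` converges, and `f_{k+1}` is a polynomial
    (∀ x y, Filter.Tendsto (fun M => SGasket.greenPartial q M x y) Filter.atTop
      (nhds (SGasket.green q x y))) ∧
    (∀ k, 0 < SGasket.normL2 q (p k)) ∧
    (∀ k x, MeasureTheory.Integrable (fun y => SGasket.green q x y * p k y) (SGasket.mu q)) ∧
    (∀ k, SGasket.IsPolynomial q (k + 1) (f (k + 1))) ∧
    -- the three-term recursion, with `p_{-1} = 0` and `p_0 = P_0`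
    p 0 = P 0 ∧
    (∀ k x, p (k + 1) x = f (k + 1) x - b k * p k x - c k * SGasket.precede p k x) ∧
    -- the second formula for `c_k`
    (∀ k, c (k + 1) = SGasket.normL2 q (p (k + 1)) ^ 2 / SGasket.normL2 q (p k) ^ 2) ∧
    -- the product formula
    (∀ k, (d k ^ 2)⁻¹ = SGasket.normL2 q (p k) ^ 2 ∧
      SGasket.normL2 q (p k) ^ 2 = (d 0 ^ 2)⁻¹ * ∏ l ∈ Finset.range k, c (l + 1)) := by
  
  have : Fact (IsEquilateral q) := ⟨hq⟩
  have hPc : ∀ k, Continuous (P k) := fun k => by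
    obtain ⟨v, hv, -⟩ := (hP k).1
    exact hv.1
  set P' : ℕ → C(gasket q, ℝ) := fun k => ⟨P k, hPc k⟩ with hP'
  set p' : ℕ → C(gasket q, ℝ) := fun k => ⟨orthoPoly q P k, continuous_orthoPoly hPc k⟩ with hp'
  have hp'c : ∀ k, ⇑(p' k) = p k := fun k => by rw [hp]; rfl
  have hpc : ∀ k, Continuous (p k) := fun k => hp'c k ▸ (p' k).continuous
  have hGS : IsGramSchmidt (ipForm q) P' p' := isGramSchmidt_orthoPoly hPc
  have hind : ∀ k, P' k ∉ spanBelow P' k := IsMonomial.notMem_spanBelow hi hP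
  have hpos : ∀ k, 0 < ipForm q (p' k) (p' k) := fun k => ipForm_self_pos (hGS.ne_zero hind k)
  have hnsq : ∀ k, normL2 q (p k) ^ 2 = ipForm q (p' k) (p' k) := fun k => by
    rw [normL2_sq, ipForm_apply, hp'c]
  have hn : ∀ k, 0 < normL2 q (p k) := fun k =>
    lt_of_le_of_ne (Real.sqrt_nonneg _) fun h => by
      have := hpos k
      rw [← hnsq, ← h] at this
      norm_num at this
  have hfT : ∀ k, f (k + 1) = greenOperator q (p' k) := fun k => by
    rw [hf, auxPoly_succ, coe_greenOperator, hp'c]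
  have hTP : ∀ l, greenOperator q (P' l) - P' (l + 1) ∈ spanBelow P' 1 := fun l => by
    obtain ⟨c, hc⟩ := potential_sub_monomial hi (hP l) (hP (l + 1)) (hP 0)
    have : greenOperator q (P' l) - P' (l + 1) = c • P' 0 :=
      ContinuousMap.ext fun x => congrFun hc x
    rw [this]
    exact Submodule.smul_mem _ _ (mem_spanBelow one_pos)
  have hsymm : ∀ u v, ipForm q u v = ipForm q v u := fun u v => ip_comm u v
  have hT : ∀ u v, ipForm q (greenOperator q u) v = ipForm q u (greenOperator q v) := fun u v =>
    ip_potential_comm u.continuous v.continuous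
  have hb' : ∀ k, b k =
      ipForm q (greenOperator q (p' k)) (p' k) / ipForm q (p' k) (p' k) := fun k => by
    rw [hb, hd, inv_pow, hnsq, hfT, ipForm_apply, ipForm_apply, ← hp'c, div_eq_inv_mul]
  have hc' : ∀ k, c (k + 1) = normL2 q (p (k + 1)) ^ 2 / normL2 q (p k) ^ 2 := fun k => by
    rw [hc, hd, hd, inv_pow, inv_pow, inv_div_inv]
  refine ⟨fun x y => ?_, hn, fun k x => integrable_green_mul (hpc k) x, fun k => ?_, ?_,
    fun k x => ?_, hc', fun k => ⟨?_, ?_⟩⟩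
  · rw [green_eq_greenSeries]
    exact tendsto_greenPartial_greenSeries x y
  · rw [hfT]
    have h1 := spanBelow_mono (Nat.le_succ (k + 1)) (hGS.map_self_sub_mem hTP k)
    have h2 := add_mem h1 (mem_spanBelow (P := P') (Nat.lt_succ_self (k + 1)))
    rw [sub_add_cancel] at h2
    exact hasLaplacianIter_of_mem_spanBelow hP h2
  · rw [hp, orthoPoly]
    simp
  · cases k with
    | zero =>
      have h := hGS.three_term_zero hsymm (fun v => ipForm_self_pos) hTP hind
      have := DFunLike.congr_fun h x
      simp only [ContinuousMap.sub_apply, ContinuousMap.smul_apply, smul_eq_mul] at this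
      rw [← hp'c, ← hp'c, hfT, hb', this]
      simp [precede]
    | succ k =>
      have h := hGS.three_term_succ hsymm (fun v => ipForm_self_pos) hT hTP hind k
      have := DFunLike.congr_fun h x
      simp only [ContinuousMap.sub_apply, ContinuousMap.smul_apply, smul_eq_mul] at this
      rw [hfT, hb', hc', hnsq, hnsq, ← hp'c, ← hp'c, precede, ← hp'c, this]
  · rw [hd, inv_pow, inv_inv]
  · induction k with
    | zero => rw [hd, inv_pow, inv_inv]; simp
    | succ k ih =>
      rw [Finset.prod_range_succ, ← mul_assoc, ← ih, hc', mul_div_cancel₀]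
      exact (pow_pos (hn k) 2).ne'
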